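/- Let $\mathfrak A^{CAR}$ be the CAR algebra over $\mathbb Z$, i.e. the unital $C^*$-algebra generated by elements $c_j$ ($j\in\mathbb Z$) with $\{c_j,c_k\}=0$ and $\{c_j,c_k^*\}=\delta_{jk}1$; let $\Theta$ be its automorphism with $\Theta(c_j)=-c_j$, and for $\Lambda\subset\mathbb Z$ let $\mathfrak A^{CAR}_\Lambda$ be the $C^*$-subalgebra generated by the $c_j$ with $j\in\Lambda$. Let $\mathfrak A=\overline{\bigotimes_{\mathbb Z}M_2(\mathbb C)}^{C^*}$ be the spin-$\tfrac12$ (UHF) algebra, $\Theta$ its automorphism with $\Theta(\sigma_x^{(j)})=-\sigma_x^{(j)}$, $\Theta(\sigma_y^{(j)})=-\sigma_y^{(j)}$, $\Theta(\sigma_z^{(j)})=\sigma_z^{(j)}$ for all $j$, and $\mathfrak A_\Lambda$ the $C^*$-subalgebra generated by the $Q^{(j)}$ with $j\in\Lambda$, $Q\in M_2(\mathbb C)$ (where $Q^{(j)}$ is $Q$ at site $j$). In both cases a subscript $+$ on an algebra denotes its subalgebra of $\Theta$-fixed elements, and a subscript $+$ on a state its restriction to the $\Theta$-fixed subalgebra;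 $(\pi_\omega,\Omega_\omega,\mathfrak H_\omega)$ is the GNS triple of a state $\omega$, $\Lambda^c=\mathbb Z\setminus\Lambda$, and $'$, $''$ denote commutant and double commutant. (i) Let $\psi$ be a $\Theta$-invariant pure state of $\mathfrak A^{CAR}$ and $\Lambda\subset\mathbb Z$. Let $\Gamma$ be the self-adjoint unitary on $\mathfrak H_\psi$ with $\Gamma\pi_\psi(Q)\Gamma^{-1}=\pi_\psi(\Theta(Q))$ and $\Gamma\Omega_\psi=\Omega_\psi$, and let $\overline\pi_\psi$ be the representation of $\mathfrak A^{CAR}$ on $\mathfrak H_\psi$ with $\overline\pi_\psi(c_j)=\pi_\psi(c_j)\Gamma$, $\overline\pi_\psi(c_j^*)=\Gamma\pi_\psi(c_j^*)$. Then twisted Haag duality for $\Lambda$, $$\pi_\psi(\mathfrak A^{CAR}_\Lambda)''=\overline\pi_\psi(\mathfrak A^{CAR}_{\Lambda^c})',$$ holds if and only if, on the GNS space $\mathfrak H_{\psi_+}$ of the state $\psi_+$ of $(\mathfrak A^{CAR})_+$, $$\pi_{\psi_+}((\mathfrak A^{CAR}_\Lambda)_+)''=\pi_{\psi_+}((\mathfrak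 A^{CAR}_{\Lambda^c})_+)'.$$ (ii) Let $\varphi$ be a $\Theta$-invariant pure state of $\mathfrak A$ and $\Lambda\subset\mathbb Z$. Then Haag duality for $\Lambda$, $\pi_\varphi(\mathfrak A_\Lambda)''=\pi_\varphi(\mathfrak A_{\Lambda^c})'$, holds if and only if, on the GNS space $\mathfrak H_{\varphi_+}$ of the state $\varphi_+$ of $(\mathfrak A)_+$, $$\pi_{\varphi_+}((\mathfrak A_\Lambda)_+)''=\pi_{\varphi_+}((\mathfrak A_{\Lambda^c})_+)'.$$ -/

import Mathlib

open scoped ComplexOrder symmDiff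

noncomputable section

namespace TwistedDuality

/-! ### C⋆-subalgebras generated by a set -/

/-- The unital C⋆-subalgebra generated by a set. -/
def cstarGen {B : Type*} [CStarAlgebra B] (s : Set B) : StarSubalgebra ℂ B :=
  (StarAlgebra.adjoin ℂ s).topologicalClosure

lemma isClosed_cstarGen {B : Type*} [CStarAlgebra B] (s : Set B) :
    IsClosed (cstarGen s : Set B) :=
  StarSubalgebra.isClosed_topologicalClosure _

lemma subset_cstarGen {B : Type*} [CStarAlgebra B] (s : Set B) : s ⊆ cstarGen s :=
  (StarAlgebra.subset_adjoin ℂ s).trans (StarSubalgebra.le_topologicalClosure _)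

lemma map_mem_cstarGen {B : Type*} [CStarAlgebra B] (s : Set B) (φ : B →⋆ₐ[ℂ] B)
    (hφ : Continuous φ) (h : ∀ x ∈ s, φ x ∈ cstarGen s) {x : B} (hx : x ∈ cstarGen s) :
    φ x ∈ cstarGen s := by
  have h1 : cstarGen s ≤ (cstarGen s).comap φ :=
    StarSubalgebra.topologicalClosure_minimal (StarAlgebra.adjoin_le h)
      ((isClosed_cstarGen s).preimage hφ)
  exact h1 hx

/-- The restriction to the C⋆-subalgebra generated by `s` of a continuous ⋆-homomorphism
that maps the generators into this subalgebra. -/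
def restrictGen {B : Type*} [CStarAlgebra B] (s : Set B) (φ : B →⋆ₐ[ℂ] B)
    (hφ : Continuous φ) (h : ∀ x ∈ s, φ x ∈ cstarGen s) : cstarGen s →⋆ₐ[ℂ] cstarGen s :=
  (φ.comp (cstarGen s).subtype).codRestrict (cstarGen s)
    fun x => map_mem_cstarGen s φ hφ h x.2

/-- Conjugation `x ↦ u x u⋆` by a unitary. -/
def conjHom {B : Type*} [CStarAlgebra B] (u : unitary B) : B →⋆ₐ[ℂ] B :=
  (Unitary.conjStarAlgAut ℂ B u : B →⋆ₐ[ℂ] B)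

lemma conjHom_apply {B : Type*} [CStarAlgebra B] (u : unitary B) (x : B) :
    conjHom u x = u * x * star (u : B) := rfl

/-! ### The Hilbert space on which both algebras are realised

Both the CAR algebra over `ℤ` and the UHF algebra `⨂_ℤ M₂(ℂ)` are simple, so each of them is the
norm closure of the ⋆-algebra generated by any realisation of its generators by bounded
operators. They are realised on the Hilbert space with orthonormal basis the finite subsets of
`ℤ` (the set of occupied sites, respectively of sites with spin up). -/

/-- The Hilbert space `ℓ²` over the finite subsets of `ℤ`. -/
abbrev Fock : Type := lp (fun _ : Finset ℤ => ℂ) 2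

lemma weighted_summable (w : Finset ℤ → ℂ) (hw : ∀ G, ‖w G‖ ≤ 1) (e : Equiv.Perm (Finset ℤ))
    (ξ : Fock) : Summable fun G => ‖w G * ξ (e G)‖ ^ (2 : ENNReal).toReal := by
  have h0 : Summable fun G => ‖ξ (e G)‖ ^ (2 : ENNReal).toReal :=
    ((lp.memℓp ξ).summable (by simp)).comp_injective e.injective
  refine Summable.of_nonneg_of_le (fun G => by positivity) (fun G => ?_) h0
  gcongr
  rw [norm_mul]
  exact mul_le_of_le_one_left (norm_nonneg _) (hw G)

/-- The bounded operator `(T ξ)(G) = w(G) ξ(e(G))`, for a weight bounded by `1` and a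
permutation `e` of the finite subsets of `ℤ`. -/
def weighted (w : Finset ℤ → ℂ) (hw : ∀ G, ‖w G‖ ≤ 1) (e : Equiv.Perm (Finset ℤ)) :
    Fock →L[ℂ] Fock :=
  LinearMap.mkContinuous
    { toFun := fun ξ => ⟨fun G => w G * ξ (e G), memℓp_gen (weighted_summable w hw e ξ)⟩
      map_add' := fun ξ η => by
        ext G
        exact mul_add _ _ _
      map_smul' := fun a ξ => by
        ext G
        simp [mul_left_comm] }
    1 fun ξ => by
      rw [one_mul]
      refine lp.norm_le_of_tsum_le (by simp) (norm_nonneg _) ?_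
      rw [lp.norm_rpow_eq_tsum (by simp) ξ,
        ← e.tsum_eq fun G => ‖ξ G‖ ^ (2 : ENNReal).toReal]
      refine (weighted_summable w hw e ξ).tsum_le_tsum (fun G => ?_)
        (((lp.memℓp ξ).summable (by simp)).comp_injective e.injective)
      change ‖w G * ξ (e G)‖ ^ _ ≤ _
      gcongr
      rw [norm_mul]
      exact mul_le_of_le_one_left (norm_nonneg _) (hw G)

@[simp]
lemma weighted_apply (w : Finset ℤ → ℂ) (hw : ∀ G, ‖w G‖ ≤ 1) (e : Equiv.Perm (Finset ℤ))
    (ξ : Fock) (G : Finset ℤ) : weighted w hw e ξ G = w G * ξ (e G) := rfl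

lemma weighted_star (w : Finset ℤ → ℂ) (hw : ∀ G, ‖w G‖ ≤ 1) (e : Equiv.Perm (Finset ℤ)) :
    star (weighted w hw e) =
      weighted (fun G => star (w (e.symm G))) (fun G => by simpa using hw _) e.symm := by
  symm
  rw [ContinuousLinearMap.star_eq_adjoint, ContinuousLinearMap.eq_adjoint_iff]
  intro ξ η
  rw [lp.inner_eq_tsum, lp.inner_eq_tsum, ← e.tsum_eq]
  refine tsum_congr fun G => ?_
  simp
  ring

lemma fock_add_apply (ξ η : Fock) (G : Finset ℤ) : (ξ + η) G = ξ G + η G := rfl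

lemma fock_smul_apply (a : ℂ) (ξ : Fock) (G : Finset ℤ) : (a • ξ) G = a * ξ G := rfl

/-- Flipping the occupation of the site `j`. -/
def toggle (j : ℤ) : Equiv.Perm (Finset ℤ) :=
  Function.Involutive.toPerm (fun G => G ∆ {j}) fun _ => symmDiff_symmDiff_cancel_right _ _

@[simp]
lemma toggle_apply (j : ℤ) (G : Finset ℤ) : toggle j G = G ∆ {j} := rfl

@[simp]
lemma toggle_symm (j : ℤ) : (toggle j).symm = toggle j := rfl

lemma neg_one_pow_card_toggle (j : ℤ) (G : Finset ℤ) :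
    (-1 : ℂ) ^ (G ∆ {j}).card = -(-1) ^ G.card := by
  by_cases hj : j ∈ G
  · have h1 : G ∆ {j} = G.erase j := by
      ext x; simp only [Finset.mem_symmDiff, Finset.mem_singleton, Finset.mem_erase]; grind
    rw [h1, ← Finset.card_erase_add_one hj, pow_succ]; ring
  · have h1 : G ∆ {j} = insert j G := by
      ext x; simp only [Finset.mem_symmDiff, Finset.mem_singleton, Finset.mem_insert]; grind
    rw [h1, Finset.card_insert_of_notMem hj, pow_succ]; ring

/-- The unitary `e ^ (i t N)`, where `N` is the number of elements of the subset. -/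
def gaugeUnitary (t : ℝ) : unitary (Fock →L[ℂ] Fock) :=
  ⟨weighted (fun G => (Circle.exp t : ℂ) ^ G.card) (fun G => by simp [norm_pow]) 1, by
    have h (G : Finset ℤ) :
        (starRingEnd ℂ) (Circle.exp t : ℂ) ^ G.card * (Circle.exp t : ℂ) ^ G.card = 1 := by
      rw [← mul_pow, mul_comm, Complex.mul_conj, Circle.normSq_coe]; simp
    have h' (G : Finset ℤ) :
        (Circle.exp t : ℂ) ^ G.card * (starRingEnd ℂ) (Circle.exp t : ℂ) ^ G.card = 1 := by
      rw [mul_comm, h]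
    constructor
    · rw [weighted_star]
      ext ξ G
      change (starRingEnd ℂ) ((Circle.exp t : ℂ) ^ G.card) *
        ((Circle.exp t : ℂ) ^ G.card * ξ G) = ξ G
      rw [← mul_assoc, map_pow, h, one_mul]
    · rw [weighted_star]
      ext ξ G
      change (Circle.exp t : ℂ) ^ G.card *
        ((starRingEnd ℂ) ((Circle.exp t : ℂ) ^ G.card) * ξ G) = ξ G
      rw [← mul_assoc, map_pow, h', one_mul]⟩

/-- Conjugation by `e ^ (i t N)`. -/
def gaugeConj (t : ℝ) : (Fock →L[ℂ] Fock) →⋆ₐ[ℂ] (Fock →L[ℂ] Fock) :=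
  conjHom (gaugeUnitary t)

lemma continuous_gaugeConj (t : ℝ) : Continuous (gaugeConj t) := by
  change Continuous fun x => (gaugeUnitary t : Fock →L[ℂ] Fock) * x *
    star (gaugeUnitary t : Fock →L[ℂ] Fock)
  fun_prop

lemma gaugeConj_apply (t : ℝ) (x : Fock →L[ℂ] Fock) :
    gaugeConj t x = (gaugeUnitary t : Fock →L[ℂ] Fock) * x *
      star (gaugeUnitary t : Fock →L[ℂ] Fock) := rfl

lemma gaugeConj_weighted (t : ℝ) (w : Finset ℤ → ℂ) (hw : ∀ G, ‖w G‖ ≤ 1)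
    (e : Equiv.Perm (Finset ℤ)) (ξ : Fock) (G : Finset ℤ) :
    gaugeConj t (weighted w hw e) ξ G =
      (Circle.exp t : ℂ) ^ G.card *
        (w G * ((starRingEnd ℂ) (Circle.exp t : ℂ) ^ (e G).card * ξ (e G))) := by
  have hs : star (gaugeUnitary t : Fock →L[ℂ] Fock) =
      weighted (fun G => star ((Circle.exp t : ℂ) ^ G.card)) (fun G => by simp [norm_pow]) 1 :=
    weighted_star (fun G => (Circle.exp t : ℂ) ^ G.card) (fun G => by simp [norm_pow]) 1
  rw [gaugeConj_apply, hs, ← map_pow]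
  rfl

lemma gaugeConj_pi_pi (x : Fock →L[ℂ] Fock) : gaugeConj Real.pi (gaugeConj Real.pi x) = x := by
  have h1 : (gaugeUnitary Real.pi : Fock →L[ℂ] Fock) * gaugeUnitary Real.pi = 1 := by
    ext ξ G
    change (Circle.exp Real.pi : ℂ) ^ G.card * ((Circle.exp Real.pi : ℂ) ^ G.card * ξ G) = ξ G
    rw [← mul_assoc, ← mul_pow]
    simp
  rw [gaugeConj_apply, gaugeConj_apply]
  have h2 := congrArg star h1
  rw [star_mul, star_one] at h2
  calc _ = ((gaugeUnitary Real.pi : Fock →L[ℂ] Fock) * gaugeUnitary Real.pi) * x *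
        (star (gaugeUnitary Real.pi : Fock →L[ℂ] Fock) *
          star (gaugeUnitary Real.pi : Fock →L[ℂ] Fock)) := by simp only [mul_assoc]
    _ = x := by rw [h1, h2, one_mul, mul_one]

/-! ### The CAR algebra over `ℤ` -/

/-- The sign `(-1) ^ #{k ∈ G | k < j}`. -/
def fermiSign (j : ℤ) (G : Finset ℤ) : ℂ := (-1) ^ (G.filter (· < j)).card

lemma fermiSign_toggle (j k : ℤ) (G : Finset ℤ) :
    fermiSign k (G ∆ {j}) = (if j < k then -1 else 1) * fermiSign k G := by
  unfold fermiSign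
  split_ifs with h
  · have h1 : (G ∆ {j}).filter (· < k) = (G.filter (· < k)) ∆ {j} := by
      ext x; simp only [Finset.mem_symmDiff, Finset.mem_singleton, Finset.mem_filter]; grind
    rw [h1, neg_one_pow_card_toggle]; ring
  · have h1 : (G ∆ {j}).filter (· < k) = G.filter (· < k) := by
      ext x; simp only [Finset.mem_symmDiff, Finset.mem_singleton, Finset.mem_filter]; grind
    rw [h1, one_mul]

lemma fermiSign_mul_self (j : ℤ) (G : Finset ℤ) : fermiSign j G * fermiSign j G = 1 := by
  rw [fermiSign, ← mul_pow]; simp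

lemma star_fermiSign (j : ℤ) (G : Finset ℤ) :
    (starRingEnd ℂ) (fermiSign j G) = fermiSign j G := by
  simp [fermiSign]

/-- The annihilation operator at the site `j` on the Fock space. -/
def annihilate (j : ℤ) : Fock →L[ℂ] Fock :=
  weighted (fun G => if j ∈ G then 0 else fermiSign j G)
    (fun G => by split_ifs <;> simp [fermiSign]) (toggle j)

lemma gaugeConj_annihilate (t : ℝ) (j : ℤ) :
    gaugeConj t (annihilate j) = (starRingEnd ℂ) (Circle.exp t : ℂ) • annihilate j := by
  ext ξ G
  rw [annihilate, gaugeConj_weighted]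
  have h : (Circle.exp t : ℂ) ^ G.card * (starRingEnd ℂ) (Circle.exp t : ℂ) ^ G.card = 1 := by
    rw [← mul_pow, Complex.mul_conj, Circle.normSq_coe]; simp
  by_cases hj : j ∈ G
  · simp [hj]
  · have hc : (toggle j G).card = G.card + 1 := by
      have hd : Disjoint G {j} := by simpa using hj
      rw [toggle_apply, hd.symmDiff_eq_sup, Finset.sup_eq_union,
        Finset.card_union_of_disjoint hd, Finset.card_singleton]
    rw [hc, pow_succ]
    simp only [hj, if_false, smul_apply, lp.coeFn_smul, Pi.smul_apply,
      weighted_apply, smul_eq_mul]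
    linear_combination (fermiSign j G * (starRingEnd ℂ) (Circle.exp t : ℂ) * ξ (toggle j G)) * h

/-- The CAR algebra over `ℤ`: the C⋆-algebra generated by the annihilation operators. -/
def CAR : Type := cstarGen (Set.range annihilate)

namespace CAR

instance : CStarAlgebra CAR :=
  haveI := isClosed_cstarGen (Set.range annihilate)
  inferInstanceAs (CStarAlgebra (cstarGen (Set.range annihilate)))

instance : PartialOrder CAR := CStarAlgebra.spectralOrder CAR

instance : StarOrderedRing CAR := CStarAlgebra.spectralOrderedRing CAR

/-- The generator `c_j`. -/
def c (j : ℤ) : CAR := ⟨annihilate j, subset_cstarGen _ ⟨j, rfl⟩⟩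

/-- The gauge automorphism `γ_t`, with `γ_t(c_j) = e^{-it} c_j`. -/
def gauge (t : ℝ) : CAR →⋆ₐ[ℂ] CAR :=
  restrictGen (Set.range annihilate) (gaugeConj t) (continuous_gaugeConj t) (by
    rintro _ ⟨j, rfl⟩
    rw [gaugeConj_annihilate]
    exact SMulMemClass.smul_mem _ (subset_cstarGen _ ⟨j, rfl⟩))

lemma gauge_c (t : ℝ) (j : ℤ) : gauge t (c j) = (starRingEnd ℂ) (Circle.exp t : ℂ) • c j :=
  Subtype.ext (gaugeConj_annihilate t j)

/-- The parity automorphism `Θ`, with `Θ(c_j) = -c_j`. -/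
def Θ : CAR →⋆ₐ[ℂ] CAR := gauge Real.pi

lemma Θ_c (j : ℤ) : Θ (c j) = -c j := by
  rw [Θ, gauge_c]; simp

/-- The C⋆-subalgebra `𝔄^{CAR}_Λ` generated by the `c_j` with `j ∈ Λ`. -/
def localAlg (Λ : Set ℤ) : StarSubalgebra ℂ CAR := cstarGen (c '' Λ)

/-- The canonical anticommutation relations `{c_j, c_k} = 0`. -/
lemma c_anticomm (j k : ℤ) : c j * c k + c k * c j = 0 := by
  refine Subtype.ext (ContinuousLinearMap.ext fun ξ => lp.ext (funext fun G => ?_))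
  change annihilate j (annihilate k ξ) G + annihilate k (annihilate j ξ) G = (0 : ℂ)
  simp only [annihilate, weighted_apply, toggle_apply, Finset.mem_symmDiff,
    Finset.mem_singleton, fermiSign_toggle]
  rcases eq_or_ne j k with rfl | hjk
  · by_cases hj : j ∈ G <;> simp [hj]
  · rw [symmDiff_right_comm]
    by_cases hj : j ∈ G <;> by_cases hk : k ∈ G <;> simp [hj, hk, hjk, hjk.symm]
    rcases lt_or_gt_of_ne hjk with h | h <;> simp [h, h.not_gt] <;> ring

/-- The canonical anticommutation relations `{c_j, c_k⋆} = δ_{jk}`. -/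
lemma c_anticomm_star (j k : ℤ) :
    c j * star (c k) + star (c k) * c j = if j = k then 1 else 0 := by
  have hs : star (annihilate k) =
      weighted (fun G => if k ∈ G ∆ {k} then 0 else fermiSign k (G ∆ {k}))
        (fun G => by split_ifs <;> simp [fermiSign]) (toggle k) := by
    rw [annihilate, weighted_star]
    congr 1
    ext G
    rw [toggle_symm, toggle_apply]
    split_ifs <;> simp [star_fermiSign]
  refine Subtype.ext (ContinuousLinearMap.ext fun ξ => lp.ext (funext fun G => ?_))
  have h0 : ((if j = k then (1 : CAR) else 0).1 ξ) G = if j = k then ξ G else 0 := by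
    split_ifs <;> rfl
  rw [h0]
  change annihilate j (star (annihilate k) ξ) G + star (annihilate k) (annihilate j ξ) G = _
  rw [hs]
  simp only [annihilate, weighted_apply, toggle_apply, Finset.mem_symmDiff,
    Finset.mem_singleton, fermiSign_toggle]
  rcases eq_or_ne j k with rfl | hjk
  · by_cases hj : j ∈ G <;> simp [hj, ← mul_assoc, fermiSign_mul_self]
  · rw [symmDiff_right_comm]
    by_cases hj : j ∈ G <;> by_cases hk : k ∈ G <;> simp [hj, hk, hjk, hjk.symm]
    rcases lt_or_gt_of_ne hjk with h | h <;> simp [h, h.not_gt] <;> ring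

end CAR

/-! ### The spin algebra `⨂_ℤ M₂(ℂ)` -/

/-- The matrix unit `e_{ab}` at the site `j`; index `0` is spin up (`j ∈ G`), `1` is spin down. -/
def siteUnit (j : ℤ) (a b : Fin 2) : Fock →L[ℂ] Fock :=
  weighted (fun G => if (if j ∈ G then 0 else 1) = a then 1 else 0)
    (fun G => by split_ifs <;> simp) (if a = b then 1 else toggle j)

/-- The operator `Q^{(j)}`: the matrix `Q` at the site `j` and the identity elsewhere. -/
def siteOp (j : ℤ) (Q : Matrix (Fin 2) (Fin 2) ℂ) : Fock →L[ℂ] Fock :=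
  ∑ a, ∑ b, Q a b • siteUnit j a b

lemma siteOp_apply (j : ℤ) (Q : Matrix (Fin 2) (Fin 2) ℂ) (ξ : Fock) (G : Finset ℤ) :
    siteOp j Q ξ G = if j ∈ G then Q 0 0 * ξ G + Q 0 1 * ξ (G ∆ {j})
      else Q 1 0 * ξ (G ∆ {j}) + Q 1 1 * ξ G := by
  simp only [siteOp, Fin.sum_univ_two, siteUnit, add_apply, smul_apply, fock_add_apply,
    fock_smul_apply, weighted_apply]
  by_cases hj : j ∈ G <;> simp [hj]

lemma gaugeConj_siteUnit (j : ℤ) (a b : Fin 2) :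
    gaugeConj Real.pi (siteUnit j a b) = (if a = b then (1 : ℂ) else -1) • siteUnit j a b := by
  ext ξ G
  rw [siteUnit, gaugeConj_weighted]
  have h (n : ℕ) : (-1 : ℂ) ^ n * (-1) ^ n = 1 := by rw [← mul_pow]; simp
  by_cases hab : a = b
  · simp [hab]
    split_ifs <;> simp [← mul_assoc, h]
  · have hc : (-1 : ℂ) ^ G.card * (-1) ^ (G ∆ {j}).card = -1 := by
      rw [neg_one_pow_card_toggle, mul_neg, h]
    simp [hab]
    split_ifs <;> simp [← mul_assoc, hc]

lemma gaugeConj_siteOp (j : ℤ) (Q : Matrix (Fin 2) (Fin 2) ℂ) :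
    gaugeConj Real.pi (siteOp j Q) =
      siteOp j (Matrix.of fun a b => (if a = b then 1 else -1) * Q a b) := by
  simp only [siteOp, map_sum, map_smul, gaugeConj_siteUnit, smul_smul, Matrix.of_apply, mul_comm]

/-- The C⋆-algebra of the spin chain: the UHF algebra generated by all `Q^{(j)}`. -/
def Spin : Type := cstarGen (Set.range fun x : ℤ × Matrix (Fin 2) (Fin 2) ℂ => siteOp x.1 x.2)

namespace Spin

instance : CStarAlgebra Spin :=
  haveI := isClosed_cstarGen
    (Set.range fun x : ℤ × Matrix (Fin 2) (Fin 2) ℂ => siteOp x.1 x.2)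
  inferInstanceAs (CStarAlgebra
    (cstarGen (Set.range fun x : ℤ × Matrix (Fin 2) (Fin 2) ℂ => siteOp x.1 x.2)))

instance : PartialOrder Spin := CStarAlgebra.spectralOrder Spin

instance : StarOrderedRing Spin := CStarAlgebra.spectralOrderedRing Spin

/-- The element `Q^{(j)}` of the spin algebra. -/
def site (j : ℤ) (Q : Matrix (Fin 2) (Fin 2) ℂ) : Spin :=
  ⟨siteOp j Q, subset_cstarGen _ ⟨(j, Q), rfl⟩⟩

lemma site_one (j : ℤ) : site j 1 = 1 := by
  refine Subtype.ext (ContinuousLinearMap.ext fun ξ => lp.ext (funext fun G => ?_))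
  change siteOp j 1 ξ G = ξ G
  by_cases hj : j ∈ G <;> simp [siteOp_apply, hj]

lemma site_mul (j : ℤ) (P Q : Matrix (Fin 2) (Fin 2) ℂ) :
    site j (P * Q) = site j P * site j Q := by
  refine Subtype.ext (ContinuousLinearMap.ext fun ξ => lp.ext (funext fun G => ?_))
  change siteOp j (P * Q) ξ G = siteOp j P (siteOp j Q ξ) G
  by_cases hj : j ∈ G <;>
    simp [siteOp_apply, hj, Matrix.mul_apply, Finset.mem_symmDiff] <;> ring

lemma site_star (j : ℤ) (Q : Matrix (Fin 2) (Fin 2) ℂ) :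
    site j (star Q) = star (site j Q) := by
  refine Subtype.ext ?_
  change siteOp j (star Q) = star (siteOp j Q)
  have hu (a b : Fin 2) : star (siteUnit j a b) = siteUnit j b a := by
    rw [siteUnit, weighted_star]
    refine ContinuousLinearMap.ext fun ξ => lp.ext (funext fun G => ?_)
    have h1 : (Equiv.symm 1 : Equiv.Perm (Finset ℤ)) G = G := rfl
    by_cases hj : j ∈ G <;> fin_cases a <;> fin_cases b <;>
      simp [siteUnit, hj, Finset.mem_symmDiff, h1]
  simp [siteOp, hu, Matrix.star_apply]
  abel

lemma site_commute {j k : ℤ} (hjk : j ≠ k) (P Q : Matrix (Fin 2) (Fin 2) ℂ) :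
    site j P * site k Q = site k Q * site j P := by
  refine Subtype.ext (ContinuousLinearMap.ext fun ξ => lp.ext (funext fun G => ?_))
  change siteOp j P (siteOp k Q ξ) G = siteOp k Q (siteOp j P ξ) G
  by_cases hj : j ∈ G <;> by_cases hk : k ∈ G <;>
    simp [siteOp_apply, hj, hk, hjk, hjk.symm, Finset.mem_symmDiff,
      symmDiff_right_comm G {k} {j}] <;> ring

/-- The automorphism `Θ` of the spin algebra: the infinite product of the `Ad σ_z^{(j)}`. -/
def Θ : Spin →⋆ₐ[ℂ] Spin :=
  restrictGen (Set.range fun x : ℤ × Matrix (Fin 2) (Fin 2) ℂ => siteOp x.1 x.2)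
    (gaugeConj Real.pi) (continuous_gaugeConj _) (by
      rintro _ ⟨⟨j, Q⟩, rfl⟩
      dsimp only
      rw [gaugeConj_siteOp]
      exact subset_cstarGen _ ⟨(j, _), rfl⟩)

/-- `Θ(σ_x) = -σ_x`, `Θ(σ_y) = -σ_y`, `Θ(σ_z) = σ_z` at every site. -/
lemma Θ_pauli (j : ℤ) :
    Θ (site j !![0, 1; 1, 0]) = -site j !![0, 1; 1, 0] ∧
    Θ (site j !![0, -Complex.I; Complex.I, 0]) = -site j !![0, -Complex.I; Complex.I, 0] ∧
    Θ (site j !![1, 0; 0, -1]) = site j !![1, 0; 0, -1] := by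
  refine ⟨Subtype.ext ?_, Subtype.ext ?_, Subtype.ext ?_⟩
  · refine (gaugeConj_siteOp j _).trans ?_
    change _ = -siteOp j _
    simp [siteOp]
    abel
  · refine (gaugeConj_siteOp j _).trans ?_
    change _ = -siteOp j _
    simp [siteOp]
    abel
  · refine (gaugeConj_siteOp j _).trans ?_
    change _ = siteOp j _
    simp [siteOp]

/-- The C⋆-subalgebra `𝔄_Λ` generated by the `Q^{(j)}` with `j ∈ Λ`. -/
def localAlg (Λ : Set ℤ) : StarSubalgebra ℂ Spin :=
  cstarGen {x | ∃ j ∈ Λ, ∃ Q, x = site j Q}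

end Spin

/-! ### States, even parts and GNS representations -/

section General

variable {A : Type*} [CStarAlgebra A] [PartialOrder A] [StarOrderedRing A]

/-- The states of a unital C⋆-algebra: normalised positive linear functionals. -/
def stateSpace (A : Type*) [CStarAlgebra A] : Set (A →ₗ[ℂ] ℂ) :=
  {f | (∀ a : A, 0 ≤ f (star a * a)) ∧ f 1 = 1}

/-- A pure state is an extreme point of the state space. -/
def IsPureState (ψ : A →ₚ[ℂ] ℂ) : Prop :=
  ψ.toLinearMap ∈ (stateSpace A).extremePoints ℝ

/-- The fixed-point subalgebra of `θ`. -/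
def evenSubalgebra (θ : A →⋆ₐ[ℂ] A) : StarSubalgebra ℂ A :=
  StarAlgHom.equalizer θ (StarAlgHom.id ℂ A)

/-- The C⋆-algebra `(𝔄)₊ = {Q | θ(Q) = Q}`. -/
def EvenPart (θ : A →⋆ₐ[ℂ] A) : Type _ := evenSubalgebra θ

namespace EvenPart

variable (θ : A →⋆ₐ[ℂ] A)

lemma isClosed : IsClosed (evenSubalgebra θ : Set A) :=
  isClosed_eq (map_continuous θ) continuous_id

instance : CStarAlgebra (EvenPart θ) :=
  haveI := isClosed θ
  inferInstanceAs (CStarAlgebra (evenSubalgebra θ))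

instance : PartialOrder (EvenPart θ) := CStarAlgebra.spectralOrder _

instance : StarOrderedRing (EvenPart θ) := CStarAlgebra.spectralOrderedRing _

/-- The inclusion of the even part. -/
def incl : EvenPart θ →⋆ₐ[ℂ] A := (evenSubalgebra θ).subtype

/-- The restriction `ψ₊` of a positive functional to the even part. -/
def restrict (ψ : A →ₚ[ℂ] ℂ) : EvenPart θ →ₚ[ℂ] ℂ :=
  PositiveLinearMap.mk₀ (ψ.toLinearMap ∘ₗ (incl θ).toAlgHom.toLinearMap) fun _ hx =>
    ψ.map_nonneg (map_nonneg (incl θ) hx)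

/-- The part of the even part that lies in the subalgebra `S`, that is `(𝔄)₊ ∩ S`. -/
def localPart (S : StarSubalgebra ℂ A) : Set (EvenPart θ) := incl θ ⁻¹' S

end EvenPart

variable (ψ : A →ₚ[ℂ] ℂ) (θ : A →⋆ₐ[ℂ] A) (h : ∀ a, ψ (θ a) = ψ a)

/-- The GNS vector. -/
def gnsVector : ψ.GNS := ((ψ.toPreGNS 1 : ψ.PreGNS) : ψ.GNS)

/-- The operator on the GNS space of a `θ`-invariant functional, which maps the vector of `a` to
the vector of `θ a`. -/
def parityOp : ψ.GNS →L[ℂ] ψ.GNS :=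
  ContinuousLinearMap.completion (LinearMap.mkContinuous
    (ψ.toPreGNS.toLinearMap ∘ₗ θ.toAlgHom.toLinearMap ∘ₗ ψ.ofPreGNS.toLinearMap) 1 fun x => by
      rw [one_mul, PositiveLinearMap.preGNS_norm_def, PositiveLinearMap.preGNS_norm_def]
      change √(ψ (star (θ (ψ.ofPreGNS x)) * θ (ψ.ofPreGNS x))).re ≤ _
      rw [← map_star, ← map_mul, h])

lemma parityOp_coe (a : A) :
    parityOp ψ θ h (ψ.toPreGNS a : ψ.PreGNS) = (ψ.toPreGNS (θ a) : ψ.PreGNS) :=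
  ContinuousLinearMap.completion_apply_coe _ _

lemma gns_coe (a b : A) :
    ψ.gnsStarAlgHom a (ψ.toPreGNS b : ψ.PreGNS) = (ψ.toPreGNS (a * b) : ψ.PreGNS) :=
  ContinuousLinearMap.completion_apply_coe _ _

lemma gns_ext {S T : ψ.GNS →L[ℂ] ψ.GNS}
    (hST : ∀ a : A, S (ψ.toPreGNS a : ψ.PreGNS) = T (ψ.toPreGNS a : ψ.PreGNS)) : S = T := by
  ext x
  induction x using UniformSpace.Completion.induction_on with
  | hp => exact isClosed_eq S.continuous T.continuous
  | ih x => exact hST x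

lemma parityOp_gnsVector : parityOp ψ θ h (gnsVector ψ) = gnsVector ψ := by
  rw [gnsVector, parityOp_coe, map_one]

lemma parityOp_mul_gns (a : A) :
    parityOp ψ θ h * ψ.gnsStarAlgHom a = ψ.gnsStarAlgHom (θ a) * parityOp ψ θ h := by
  refine gns_ext ψ fun b => ?_
  change parityOp ψ θ h (ψ.gnsStarAlgHom a _) = ψ.gnsStarAlgHom (θ a) (parityOp ψ θ h _)
  rw [gns_coe, parityOp_coe, parityOp_coe, gns_coe, map_mul]

lemma parityOp_mul_self (hθ : ∀ a, θ (θ a) = a) :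
    parityOp ψ θ h * parityOp ψ θ h = 1 := by
  refine gns_ext ψ fun b => ?_
  change parityOp ψ θ h (parityOp ψ θ h _) = _
  rw [parityOp_coe, parityOp_coe, hθ]; rfl

lemma star_parityOp (hθ : ∀ a, θ (θ a) = a) :
    star (parityOp ψ θ h) = parityOp ψ θ h := by
  symm
  rw [ContinuousLinearMap.star_eq_adjoint, ContinuousLinearMap.eq_adjoint_iff]
  intro x y
  induction x, y using UniformSpace.Completion.induction_on₂ with
  | hp => apply isClosed_eq <;> fun_prop
  | ih x y =>
    obtain ⟨x, rfl⟩ := ψ.toPreGNS.surjective x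
    obtain ⟨y, rfl⟩ := ψ.toPreGNS.surjective y
    rw [parityOp_coe, parityOp_coe, UniformSpace.Completion.inner_coe,
      UniformSpace.Completion.inner_coe, PositiveLinearMap.preGNS_inner_def,
      PositiveLinearMap.preGNS_inner_def, PositiveLinearMap.ofPreGNS_toPreGNS, ← h]
    simp only [map_mul, map_star, hθ, PositiveLinearMap.ofPreGNS_toPreGNS]

end General

/-! ### Haag duality and twisted Haag duality -/

namespace CAR

lemma Θ_Θ (a : CAR) : Θ (Θ a) = a :=
  Subtype.ext (gaugeConj_pi_pi _)

variable (ψ : CAR →ₚ[ℂ] ℂ) (h : ∀ a, ψ (Θ a) = ψ a)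

/-- The unitary `Γ` on the GNS space of a `Θ`-invariant state `ψ` that implements `Θ` and fixes
the GNS vector. -/
def Γ : ψ.GNS →L[ℂ] ψ.GNS := parityOp ψ Θ h

lemma Γ_mul_Γ : Γ ψ h * Γ ψ h = 1 := parityOp_mul_self ψ Θ h Θ_Θ

lemma star_Γ : star (Γ ψ h) = Γ ψ h := star_parityOp ψ Θ h Θ_Θ

lemma Γ_mul_gns (a : CAR) :
    Γ ψ h * ψ.gnsStarAlgHom a = ψ.gnsStarAlgHom (Θ a) * Γ ψ h := parityOp_mul_gns ψ Θ h a

lemma Γ_gnsVector : Γ ψ h (gnsVector ψ) = gnsVector ψ := parityOp_gnsVector ψ Θ h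

lemma inv_sqrt_two_mul : ((√2 : ℝ) : ℂ)⁻¹ * ((√2 : ℝ) : ℂ)⁻¹ * 2 = 1 := by
  rw [← mul_inv, ← Complex.ofReal_mul, Real.mul_self_sqrt (by norm_num)]; norm_num

/-- The operator `e^{iπΓ/4} = (1 + iΓ)/√2`. -/
def twistOp : ψ.GNS →L[ℂ] ψ.GNS := ((√2 : ℝ) : ℂ)⁻¹ • (1 + Complex.I • Γ ψ h)

lemma star_twistOp : star (twistOp ψ h) = ((√2 : ℝ) : ℂ)⁻¹ • (1 - Complex.I • Γ ψ h) := by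
  rw [twistOp, star_smul, star_add, star_smul, star_Γ]
  simp [sub_eq_add_neg]

/-- The operator `e^{iπΓ/4}` is unitary. -/
def twistUnitary : unitary (ψ.GNS →L[ℂ] ψ.GNS) :=
  ⟨twistOp ψ h, by
    have h3 : (1 - Complex.I • Γ ψ h) * (1 + Complex.I • Γ ψ h) = (2 : ℂ) • 1 := by
      simp only [sub_mul, mul_add, one_mul, mul_one, smul_mul_smul_comm, Γ_mul_Γ,
        Complex.I_mul_I]
      module
    have h4 : (1 + Complex.I • Γ ψ h) * (1 - Complex.I • Γ ψ h) = (2 : ℂ) • 1 := by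
      simp only [add_mul, mul_sub, one_mul, mul_one, smul_mul_smul_comm, Γ_mul_Γ,
        Complex.I_mul_I]
      module
    constructor
    · rw [star_twistOp, twistOp, smul_mul_smul_comm, h3, smul_smul, inv_sqrt_two_mul, one_smul]
    · rw [star_twistOp, twistOp, smul_mul_smul_comm, h4, smul_smul, inv_sqrt_two_mul, one_smul]⟩

/-- The twisted representation `π̄_ψ` of the CAR algebra on the GNS space of `ψ`. It is
characterised by its values on the generators, see `twistedRep_c` and `twistedRep_star_c`. -/
def twistedRep : CAR →⋆ₐ[ℂ] (ψ.GNS →L[ℂ] ψ.GNS) :=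
  (conjHom (twistUnitary ψ h)).comp (ψ.gnsStarAlgHom.comp (gauge (-(Real.pi / 2))))

lemma twistedRep_c (j : ℤ) : twistedRep ψ h (c j) = ψ.gnsStarAlgHom (c j) * Γ ψ h := by
  have hg : gauge (-(Real.pi / 2)) (c j) = Complex.I • c j := by
    rw [gauge_c, Circle.coe_exp, ← Complex.exp_conj]
    congr 1
    rw [← Complex.exp_pi_div_two_mul_I]
    congr 1
    simp [map_ofNat]
  have hc : Γ ψ h * ψ.gnsStarAlgHom (c j) = -(ψ.gnsStarAlgHom (c j) * Γ ψ h) := by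
    rw [Γ_mul_gns, Θ_c, map_neg, neg_mul]
  change twistOp ψ h * ψ.gnsStarAlgHom (gauge _ (c j)) * star (twistOp ψ h) = _
  rw [hg, map_smul, star_twistOp, twistOp]
  set p := ψ.gnsStarAlgHom (c j) with hp
  simp only [smul_mul_assoc, mul_smul_comm, add_mul, mul_sub, one_mul, mul_one, hc, neg_mul,
    mul_assoc, Γ_mul_Γ, smul_smul, smul_sub, smul_add, smul_neg]
  have h2 := inv_sqrt_two_mul
  generalize ((√2 : ℝ) : ℂ)⁻¹ = s at *
  match_scalars
  · linear_combination s * s * Complex.I * Complex.I_mul_I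
  · linear_combination h2 - 2 * s * s * Complex.I_mul_I

lemma twistedRep_star_c (j : ℤ) :
    twistedRep ψ h (star (c j)) = Γ ψ h * ψ.gnsStarAlgHom (star (c j)) := by
  rw [map_star, twistedRep_c, star_mul, star_Γ, map_star]

/-- Twisted Haag duality for `Λ`: `π_ψ(𝔄^{CAR}_Λ)'' = π̄_ψ(𝔄^{CAR}_{Λᶜ})'`. -/
def TwistedHaagDuality (Λ : Set ℤ) : Prop :=
  (ψ.gnsStarAlgHom '' (localAlg Λ : Set CAR)).centralizer.centralizer =
    (twistedRep ψ h '' (localAlg Λᶜ : Set CAR)).centralizer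

/-- Duality of the even parts on the GNS space of `ψ₊`:
`π_{ψ₊}((𝔄^{CAR}_Λ)₊)'' = π_{ψ₊}((𝔄^{CAR}_{Λᶜ})₊)'`. -/
def EvenHaagDuality (Λ : Set ℤ) : Prop :=
  ((EvenPart.restrict Θ ψ).gnsStarAlgHom ''
      EvenPart.localPart Θ (localAlg Λ)).centralizer.centralizer =
    ((EvenPart.restrict Θ ψ).gnsStarAlgHom '' EvenPart.localPart Θ (localAlg Λᶜ)).centralizer

end CAR

namespace Spin

variable (φ : Spin →ₚ[ℂ] ℂ)

/-- Haag duality for `Λ` in the GNS representation: `π_φ(𝔄_Λ)'' = π_φ(𝔄_{Λᶜ})'`. -/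
def HaagDuality (Λ : Set ℤ) : Prop :=
  (φ.gnsStarAlgHom '' (localAlg Λ : Set Spin)).centralizer.centralizer =
    (φ.gnsStarAlgHom '' (localAlg Λᶜ : Set Spin)).centralizer

/-- Duality of the even parts on the GNS space of `φ₊`:
`π_{φ₊}((𝔄_Λ)₊)'' = π_{φ₊}((𝔄_{Λᶜ})₊)'`. -/
def EvenHaagDuality (Λ : Set ℤ) : Prop :=
  ((EvenPart.restrict Θ φ).gnsStarAlgHom ''
      EvenPart.localPart Θ (localAlg Λ)).centralizer.centralizer =
    ((EvenPart.restrict Θ φ).gnsStarAlgHom '' EvenPart.localPart Θ (localAlg Λᶜ)).centralizer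

end Spin

end TwistedDuality

end

/-! The projection `p = (1 + Γ) / 2` onto the even vectors identifies the GNS space of the even
algebra with the range of `p` in the GNS space of the whole algebra. The local algebra of a nonempty
region contains an odd element that squares to `1`. Conjugation by it moves operators between `p`
and `1 - p`, so that every operator on that range commuting with the even part of the local algebra
extends to an operator commuting with all of it: commutants compress to commutants. Conversely, an
even operator that commutes with an odd involution of the complement is determined by its
compression. The twist fixes all even operators, and so does not affect compressions. Only the
regions `∅` and `ℤ` lack an odd element on one side, and there both dualities hold because the GNS
representation of a pure state is irreducible. -/

noncomputable section

namespace TwistedDuality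

section Graded

variable {R R₀ : Type*} [Ring R] [Ring R₀] {p U V x y : R} {S T : Set R} {j : R₀ →ₙ+* R}

/-- The diagonal part of `x` for the decomposition of the unit into `p` and `1 - p`. When `p` is the
projection onto the even vectors of a `ℤ/2`-graded space, this is the even part of an operator. -/
def evenPart (p x : R) : R := p * x * p + (1 - p) * x * (1 - p)

lemma commute_evenPart (hp : IsIdempotentElem p) (x : R) : Commute p (evenPart p x) := by
  rw [commute_iff_eq, evenPart, mul_add, add_mul, mul_assoc _ p p, mul_assoc _ (1 - p) p,
    hp.one_sub_mul_self, mul_assoc (1 - p), ← mul_assoc p (1 - p), hp.mul_one_sub_self,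
    ← mul_assoc, ← mul_assoc, hp.eq]
  simp

lemma evenPart_eq_self (hp : IsIdempotentElem p) (h : Commute p x) : evenPart p x = x := by
  rw [evenPart, h.eq, ((Commute.one_left x).sub_left h).eq, mul_assoc, hp.eq, mul_assoc,
    hp.one_sub.eq]
  noncomm_ring

/-- `U` is an involution which is odd for the `ℤ/2`-grading with even projection `p`, that is, it
exchanges `p` and `1 - p`. -/
structure IsOddInvolution (p U : R) : Prop where
  mul_self : U * U = 1
  mul_eq : p * U = U * (1 - p)

namespace IsOddInvolution

lemma mul_eq' (hU : IsOddInvolution p U) : U * p = (1 - p) * U := by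
  rw [sub_mul, hU.mul_eq]; noncomm_ring

lemma conj_eq (hU : IsOddInvolution p U) : U * p * U = 1 - p := by
  rw [hU.mul_eq', mul_assoc, hU.mul_self, mul_one]

lemma conj_one_sub_eq (hU : IsOddInvolution p U) : U * (1 - p) * U = p := by
  rw [← hU.mul_eq, mul_assoc, hU.mul_self, mul_one]

lemma commute_conj (hU : IsOddInvolution p U) (hx : Commute p x) : Commute p (U * x * U) :=
  calc p * (U * x * U) = U * ((1 - p) * x) * U := by
        rw [← mul_assoc, ← mul_assoc, hU.mul_eq]; noncomm_ring
    _ = U * (x * (1 - p)) * U := by rw [((Commute.one_left x).sub_left hx).eq]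
    _ = U * x * U * p := by rw [mul_assoc (U * x) U, hU.mul_eq']; noncomm_ring

lemma evenPart_add_evenPart_mul (hU : IsOddInvolution p U) (x : R) :
    evenPart p x + evenPart p (x * U) * U = x :=
  calc evenPart p x + evenPart p (x * U) * U
      = evenPart p x + (p * x * (U * p * U) + (1 - p) * x * (U * (1 - p) * U)) := by
        simp only [evenPart, add_mul, mul_assoc]
    _ = x := by rw [hU.conj_eq, hU.conj_one_sub_eq, evenPart]; noncomm_ring

lemma eq_of_mul_eq (hV : IsOddInvolution p V) (hx : Commute V x) (hy : Commute V y)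
    (h : p * x = p * y) : x = y := by
  have one_sub_mul {z : R} (hz : Commute V z) : (1 - p) * z = V * (p * z) * V := by
    rw [← hV.conj_eq, mul_assoc, hz.eq]; simp only [mul_assoc]
  calc x = p * x + (1 - p) * x := by noncomm_ring
    _ = p * y + (1 - p) * y := by rw [one_sub_mul hx, one_sub_mul hy, h]
    _ = y := by noncomm_ring

end IsOddInvolution

/-- A set of elements of a ring which is a `ℤ/2`-graded multiplicative system for the grading with
even projection `p`, and which has an invertible odd element; one that squares to `1` suffices
here. -/
structure IsGraded (p : R) (S : Set R) : Prop where
  mul_mem : ∀ ⦃x⦄, x ∈ S → ∀ ⦃y⦄, y ∈ S → x * y ∈ S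
  evenPart_mem : ∀ ⦃x⦄, x ∈ S → evenPart p x ∈ S
  exists_odd : ∃ U ∈ S, IsOddInvolution p U

lemma IsGraded.mem_centralizer (hp : IsIdempotentElem p) (hS : IsGraded p S)
    (hU : IsOddInvolution p U) (hUS : U ∈ S) (hxU : Commute x U)
    (hx : ∀ s ∈ S, Commute p s → Commute x s) : x ∈ S.centralizer := by
  intro s hs
  have even {r : R} (hr : r ∈ S) : Commute x (evenPart p r) :=
    hx _ (hS.evenPart_mem hr) (commute_evenPart hp r)
  have := (even hs).add_right ((even (hS.mul_mem hs hUS)).mul_right hxU)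
  rw [hU.evenPart_add_evenPart_mul] at this
  exact this.eq.symm

lemma IsGraded.evenPart_mem_centralizer (hp : IsIdempotentElem p) (hS : IsGraded p S)
    (hx : x ∈ S.centralizer) : evenPart p x ∈ S.centralizer := by
  obtain ⟨U, hUS, hU⟩ := hS.exists_odd
  have hxU : Commute x U := (hx U hUS).symm
  refine hS.mem_centralizer hp hU hUS ?_ fun s hs hps => ?_
  · calc evenPart p x * U
        = p * x * (p * U) + (1 - p) * x * ((1 - p) * U) := by
          simp only [evenPart, add_mul, mul_assoc]
      _ = p * (x * U) * (1 - p) + (1 - p) * (x * U) * p := by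
        rw [hU.mul_eq, ← hU.mul_eq']; noncomm_ring
      _ = (p * U) * x * (1 - p) + ((1 - p) * U) * x * p := by rw [hxU.eq]; noncomm_ring
      _ = U * evenPart p x := by rw [hU.mul_eq, ← hU.mul_eq', evenPart]; noncomm_ring
  · have hxs : Commute x s := (hx s hs).symm
    have hps' : Commute (1 - p) s := (Commute.one_left s).sub_left hps
    exact ((hps.mul_left hxs).mul_left hps).add_left ((hps'.mul_left hxs).mul_left hps')

lemma IsGraded.centralizer (hp : IsIdempotentElem p) (hS : IsGraded p S)
    (hV : ∃ V ∈ S.centralizer, IsOddInvolution p V) : IsGraded p S.centralizer where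
  mul_mem _ hx _ hy := Set.mul_mem_centralizer hx hy
  evenPart_mem _ := hS.evenPart_mem_centralizer hp
  exists_odd := hV

/-- `j` identifies the ring `R₀` with the corner `j 1 * R * j 1` of the ring `R`. -/
structure IsCornerEmbedding (j : R₀ →ₙ+* R) : Prop where
  injective : Function.Injective j
  exists_eq : ∀ x, ∃ a, j a = j 1 * x * j 1

lemma isIdempotentElem_map_one (j : R₀ →ₙ+* R) : IsIdempotentElem (j 1) := by
  rw [IsIdempotentElem, ← map_mul, one_mul]

lemma IsCornerEmbedding.exists_eq_of_commute (hj : IsCornerEmbedding j) (hx : Commute (j 1) x) :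
    ∃ a, j a = j 1 * x := by
  obtain ⟨a, ha⟩ := hj.exists_eq x
  exact ⟨a, by rw [ha, mul_assoc, ← hx.eq, ← mul_assoc, (isIdempotentElem_map_one j).eq]⟩

/-- The compression to the corner `R₀` of the elements of `S` that are even for the grading with
even projection `j 1`. -/
def evenCompression (j : R₀ →ₙ+* R) (S : Set R) : Set R₀ :=
  {a | ∃ s ∈ S, Commute (j 1) s ∧ j a = j 1 * s}

lemma commute_of_mem_evenCompression (hj : Function.Injective j) {a b : R₀}
    (ha : a ∈ evenCompression j S.centralizer) (hb : b ∈ evenCompression j S) : Commute a b := by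
  obtain ⟨t, ht, hpt, hat⟩ := ha
  obtain ⟨s, hs, hps, hbs⟩ := hb
  have hts : Commute t s := (ht s hs).symm
  have hp : Commute (j 1) (j 1) := Commute.refl _
  apply hj
  rw [map_mul, map_mul, hat, hbs]
  exact (hp.mul_right hps).mul_left (hpt.symm.mul_right hts)

/-- An operator `a` on the even subspace that commutes with the compressions of the even elements
extends to the whole space as `a ⊕ U a U`. -/
lemma IsGraded.mem_evenCompression_centralizer (hj : IsCornerEmbedding j)
    (hS : IsGraded (j 1) S) {a : R₀} (ha : a ∈ (evenCompression j S).centralizer) :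
    a ∈ evenCompression j S.centralizer := by
  have hp := isIdempotentElem_map_one j
  obtain ⟨U, hUS, hU⟩ := hS.exists_odd
  have hpa : j 1 * j a = j a := by rw [← map_mul, one_mul]
  have hap : j a * j 1 = j a := by rw [← map_mul, mul_one]
  have hcomm : Commute (j 1) (j a) := hpa.trans hap.symm
  have even {s : R} (hs : s ∈ S) (hps : Commute (j 1) s) : Commute (j a) s := by
    obtain ⟨b, hb⟩ := hj.exists_eq_of_commute hps
    have hab := congrArg j (ha b ⟨s, hs, hps, hb⟩)
    rw [map_mul, map_mul, hb] at hab
    calc j a * s = j a * (j 1 * s) := by rw [← mul_assoc, hap]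
      _ = j 1 * s * j a := hab.symm
      _ = s * j a := by rw [hps.eq, mul_assoc, hpa]
  refine ⟨j a + U * j a * U, hS.mem_centralizer hp hU hUS ?_ fun s hs hps => ?_, ?_, ?_⟩
  · rw [commute_iff_eq, add_mul, mul_add, mul_assoc _ U U, hU.mul_self, ← mul_assoc U,
      ← mul_assoc U, hU.mul_self, mul_one, one_mul, add_comm]
  · have hsU : Commute (j a) (U * s * U) :=
      even (hS.mul_mem (hS.mul_mem hUS hs) hUS) (hU.commute_conj hps)
    have hconj : U * j a * U * s = s * (U * j a * U) :=
      calc U * j a * U * s = U * (j a * (U * s * U)) * U := by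
            simp only [mul_assoc, hU.mul_self, mul_one]
        _ = U * U * (s * U * j a * U) := by rw [hsU.eq]; simp only [mul_assoc]
        _ = s * (U * j a * U) := by rw [hU.mul_self, one_mul]; simp only [mul_assoc]
    exact (even hs hps).add_left hconj
  · exact hcomm.add_right (hU.commute_conj hcomm)
  · have hqa : (1 - j 1) * j a = 0 := by rw [sub_mul, hpa, one_mul, sub_self]
    rw [mul_add, hpa, ← mul_assoc, ← mul_assoc, hU.mul_eq, mul_assoc U, hqa]
    simp

theorem IsGraded.centralizer_evenCompression (hj : IsCornerEmbedding j) (hS : IsGraded (j 1) S) :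
    (evenCompression j S).centralizer = evenCompression j S.centralizer :=
  Set.Subset.antisymm (fun _ => hS.mem_evenCompression_centralizer hj)
    fun _ ha _ hb => (commute_of_mem_evenCompression hj.injective ha hb).eq.symm

/-- An even element of `T'` is determined by its compression because it commutes with an odd
involution in `T`. -/
lemma IsGraded.centralizer_subset_of_evenCompression_subset (hj : IsCornerEmbedding j)
    (hS : IsGraded (j 1) S) (hT : IsGraded (j 1) T) (hST : S ⊆ T.centralizer)
    (h : evenCompression j T.centralizer ⊆ evenCompression j S.centralizer.centralizer) :
    T.centralizer ⊆ S.centralizer.centralizer := by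
  have hp := isIdempotentElem_map_one j
  obtain ⟨U, hUS, hU⟩ := hS.exists_odd
  obtain ⟨V, hVT, hV⟩ := hT.exists_odd
  have hVS : V ∈ S.centralizer := fun s hs => (hST hs V hVT).symm
  have even {y : R} (hy : y ∈ T.centralizer) : evenPart (j 1) y ∈ S.centralizer.centralizer := by
    have hy := hT.evenPart_mem_centralizer hp hy
    have hpy := commute_evenPart hp y
    obtain ⟨a, ha⟩ := hj.exists_eq_of_commute hpy
    obtain ⟨s, hs, -, has⟩ := h ⟨_, hy, hpy, ha⟩
    rwa [hV.eq_of_mul_eq (hy V hVT) (hs V hVS) (ha.symm.trans has)]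
  intro y hy
  rw [← hU.evenPart_add_evenPart_mul y]
  exact Set.add_mem_centralizer (even hy) (Set.mul_mem_centralizer
    (even (Set.mul_mem_centralizer hy (hST hUS))) (Set.subset_centralizer_centralizer hUS))

theorem IsGraded.duality_iff (hj : IsCornerEmbedding j) (hS : IsGraded (j 1) S)
    (hT : IsGraded (j 1) T) (hST : S ⊆ T.centralizer) :
    S.centralizer.centralizer = T.centralizer ↔
      (evenCompression j S).centralizer.centralizer = (evenCompression j T).centralizer := by
  have hp := isIdempotentElem_map_one j
  obtain ⟨V, hVT, hV⟩ := hT.exists_odd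
  have hTS : T ⊆ S.centralizer := fun t ht s hs => (hST hs t ht).symm
  have hS' : IsGraded (j 1) S.centralizer := hS.centralizer hp ⟨V, hTS hVT, hV⟩
  rw [hS.centralizer_evenCompression hj, hS'.centralizer_evenCompression hj,
    hT.centralizer_evenCompression hj]
  refine ⟨fun h => by rw [h], fun h => (Set.centralizer_subset hTS).antisymm ?_⟩
  exact hS.centralizer_subset_of_evenCompression_subset hj hT hST h.ge

lemma evenCompression_subset_center (hj : IsCornerEmbedding j) (hS : S ⊆ Set.center R) :
    evenCompression j S ⊆ Set.center R₀ := by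
  rintro a ⟨s, hs, -, ha⟩
  refine Semigroup.mem_center_iff.2 fun b => hj.injective ?_
  have hs := Semigroup.mem_center_iff.1 (hS hs)
  calc j (b * a) = j b * j 1 * s := by rw [map_mul, ha, mul_assoc]
    _ = j 1 * j b * s := by rw [← map_mul, ← map_mul, mul_one, one_mul]
    _ = j (a * b) := by rw [map_mul, ha, mul_assoc, mul_assoc, hs]

lemma centralizer_centralizer_eq_of_subset_center {M : Type*} [Semigroup M]
    {S T : Set M} (hS : S ⊆ Set.center M) (hT : T.centralizer ⊆ Set.center M) :
    S.centralizer.centralizer = T.centralizer := by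
  rw [Set.centralizer_eq_top_iff_subset.2 hS, Set.centralizer_univ]
  exact (Set.center_subset_centralizer T).antisymm hT

lemma IsGraded.duality_iff_of_left_subset_center (hj : IsCornerEmbedding j)
    (hT : IsGraded (j 1) T) (hS : S ⊆ Set.center R) (hT' : T.centralizer ⊆ Set.center R) :
    S.centralizer.centralizer = T.centralizer ↔
      (evenCompression j S).centralizer.centralizer = (evenCompression j T).centralizer := by
  refine iff_of_true (centralizer_centralizer_eq_of_subset_center hS hT')
    (centralizer_centralizer_eq_of_subset_center (evenCompression_subset_center hj hS) ?_)
  rw [hT.centralizer_evenCompression hj]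
  exact evenCompression_subset_center hj hT'

lemma IsGraded.duality_iff_of_right_subset_center (hj : IsCornerEmbedding j)
    (hS : IsGraded (j 1) S) (hS' : S.centralizer ⊆ Set.center R) (hT : T ⊆ Set.center R) :
    S.centralizer.centralizer = T.centralizer ↔
      (evenCompression j S).centralizer.centralizer = (evenCompression j T).centralizer := by
  rw [hS.centralizer_evenCompression hj]
  have hcenter {X : Set R} (hX : X ⊆ Set.center R) := evenCompression_subset_center hj hX
  simp only [Set.centralizer_eq_top_iff_subset.2, hS', hT, hcenter]

section Twist

variable {e : R ≃+* R}

lemma IsGraded.image (he : ∀ x, Commute p x → e x = x) (hS : IsGraded p S) :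
    IsGraded p (e '' S) where
  mul_mem := by
    rintro _ ⟨x, hx, rfl⟩ _ ⟨y, hy, rfl⟩
    exact ⟨x * y, hS.mul_mem hx hy, map_mul e x y⟩
  evenPart_mem := by
    rintro _ ⟨x, hx, rfl⟩
    refine ⟨evenPart p x, hS.evenPart_mem hx, ?_⟩
    simp only [evenPart, map_add, map_mul, map_sub, map_one, he p (Commute.refl p)]
  exists_odd := by
    obtain ⟨U, hUS, hU⟩ := hS.exists_odd
    refine ⟨e U, ⟨U, hUS, rfl⟩, by rw [← map_mul, hU.mul_self, map_one], ?_⟩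
    have h := congrArg e hU.mul_eq
    rwa [map_mul, map_mul, map_sub, map_one, he p (Commute.refl p)] at h

lemma evenCompression_image (he : ∀ x, Commute (j 1) x → e x = x) (S : Set R) :
    evenCompression j (e '' S) = evenCompression j S := by
  have hep := he _ (Commute.refl (j 1))
  ext a
  constructor
  · rintro ⟨_, ⟨s, hs, rfl⟩, hps, has⟩
    have hps' : Commute (j 1) s := e.injective (by simpa only [map_mul, hep] using hps.eq)
    rw [he s hps'] at has
    exact ⟨s, hs, hps', has⟩
  · rintro ⟨s, hs, hps, has⟩
    exact ⟨s, ⟨s, hs, he s hps⟩, hps, has⟩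

lemma image_subset_center (e : R ≃+* R) (hS : S ⊆ Set.center R) : e '' S ⊆ Set.center R := by
  rintro _ ⟨x, hx, rfl⟩
  exact MulEquivClass.apply_mem_center e (hS hx)

lemma centralizer_image_subset_center (e : R ≃+* R) (hS : S.centralizer ⊆ Set.center R) :
    (e '' S).centralizer ⊆ Set.center R := by
  intro x hx
  rw [← MulEquivClass.apply_mem_center_iff e.symm]
  refine hS fun s hs => e.injective ?_
  simpa only [map_mul, e.apply_symm_apply] using hx (e s) ⟨s, hs, rfl⟩

end Twist

end Graded

section Corner

variable {𝕜 H₀ H : Type*} [RCLike 𝕜] [NormedAddCommGroup H₀] [InnerProductSpace 𝕜 H₀]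
  [CompleteSpace H₀] [NormedAddCommGroup H] [InnerProductSpace 𝕜 H] [CompleteSpace H]

lemma adjoint_apply_apply (J : H₀ →ₗᵢ[𝕜] H) (v : H₀) :
    J.toContinuousLinearMap.adjoint (J v) = v :=
  DFunLike.congr_fun J.adjoint_comp_self v

/-- The embedding `x ↦ J x J†` of the operators on `H₀` as the operators on `H` that live on the
range of the isometry `J`. It is multiplicative but not unital. -/
def cornerHom (J : H₀ →ₗᵢ[𝕜] H) : (H₀ →L[𝕜] H₀) →ₙ+* (H →L[𝕜] H) where
  toFun x := J.toContinuousLinearMap ∘L x ∘L J.toContinuousLinearMap.adjoint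
  map_mul' x y := by ext v; simp [adjoint_apply_apply]
  map_zero' := by ext; simp
  map_add' x y := by ext; simp

lemma cornerHom_apply_apply (J : H₀ →ₗᵢ[𝕜] H) (x : H₀ →L[𝕜] H₀) (v : H) :
    cornerHom J x v = J (x (J.toContinuousLinearMap.adjoint v)) := rfl

lemma isCornerEmbedding_cornerHom (J : H₀ →ₗᵢ[𝕜] H) : IsCornerEmbedding (cornerHom J) where
  injective x y hxy := by
    ext v
    have h := DFunLike.congr_fun hxy (J v)
    rw [cornerHom_apply_apply, cornerHom_apply_apply, adjoint_apply_apply] at h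
    exact J.injective h
  exists_eq x := ⟨J.toContinuousLinearMap.adjoint ∘L x ∘L J.toContinuousLinearMap, rfl⟩

end Corner

section EvenGNS

open ContinuousLinearMap (adjoint)

variable {A : Type*} [CStarAlgebra A] [PartialOrder A] [StarOrderedRing A] (ψ : A →ₚ[ℂ] ℂ)
  {θ : A →⋆ₐ[ℂ] A}

variable (θ) in
/-- The isometry between GNS spaces that maps the vector of an even element, in the GNS space of
the even algebra, to its vector in the GNS space of the whole algebra. -/
def evenIsometry : (EvenPart.restrict θ ψ).GNS →ₗᵢ[ℂ] ψ.GNS :=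
  let V : (EvenPart.restrict θ ψ).PreGNS →ₗᵢ[ℂ] ψ.PreGNS :=
    { ψ.toPreGNS.toLinearMap ∘ₗ (EvenPart.incl θ).toAlgHom.toLinearMap ∘ₗ
        (EvenPart.restrict θ ψ).ofPreGNS.toLinearMap with
      norm_map' := fun x => by
        rw [PositiveLinearMap.preGNS_norm_def, PositiveLinearMap.preGNS_norm_def]
        change √(ψ (star (EvenPart.incl θ _) * EvenPart.incl θ _)).re = _
        rw [← map_star, ← map_mul]
        rfl }
  { V.toContinuousLinearMap.completion.toLinearMap with
    norm_map' := V.isometry.completion_map.norm_map_of_map_zero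
        V.toContinuousLinearMap.completion.map_zero }

lemma evenIsometry_coe (a : EvenPart θ) :
    evenIsometry ψ θ ((EvenPart.restrict θ ψ).toPreGNS a : (EvenPart.restrict θ ψ).PreGNS) =
      (ψ.toPreGNS (EvenPart.incl θ a) : ψ.PreGNS) :=
  ContinuousLinearMap.completion_apply_coe _ _

lemma map_incl (a : EvenPart θ) : θ (EvenPart.incl θ a) = EvenPart.incl θ a := a.2

lemma gns_incl_evenIsometry (a : EvenPart θ) (v : (EvenPart.restrict θ ψ).GNS) :
    ψ.gnsStarAlgHom (EvenPart.incl θ a) (evenIsometry ψ θ v) =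
      evenIsometry ψ θ ((EvenPart.restrict θ ψ).gnsStarAlgHom a v) := by
  induction v using UniformSpace.Completion.induction_on with
  | hp => exact isClosed_eq (by fun_prop) (by fun_prop)
  | ih v =>
    obtain ⟨b, rfl⟩ := (EvenPart.restrict θ ψ).toPreGNS.surjective v
    rw [gns_coe, evenIsometry_coe, evenIsometry_coe, gns_coe,
      map_mul (EvenPart.incl θ)]

/-- The even part `(a + θ a) / 2` of `a`. -/
def evenElem (hθ : ∀ a, θ (θ a) = a) (a : A) : EvenPart θ :=
  ⟨(1 / 2 : ℂ) • (a + θ a), by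
    change θ ((1 / 2 : ℂ) • (a + θ a)) = (1 / 2 : ℂ) • (a + θ a)
    rw [map_smul, map_add, hθ, add_comm]⟩

lemma incl_evenElem (hθ : ∀ a, θ (θ a) = a) (a : A) :
    EvenPart.incl θ (evenElem hθ a) = (1 / 2 : ℂ) • (a + θ a) := rfl

variable {ψ} (h : ∀ a, ψ (θ a) = ψ a) (hθ : ∀ a, θ (θ a) = a)

lemma parityOp_evenIsometry (v : (EvenPart.restrict θ ψ).GNS) :
    parityOp ψ θ h (evenIsometry ψ θ v) = evenIsometry ψ θ v := by
  induction v using UniformSpace.Completion.induction_on with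
  | hp => exact isClosed_eq (by fun_prop) (by fun_prop)
  | ih v =>
    obtain ⟨b, rfl⟩ := (EvenPart.restrict θ ψ).toPreGNS.surjective v
    rw [evenIsometry_coe, parityOp_coe, map_incl]

include hθ in
lemma cornerHom_evenIsometry_one :
    cornerHom (evenIsometry ψ θ) 1 = (1 / 2 : ℂ) • (1 + parityOp ψ θ h) := by
  set J := evenIsometry ψ θ
  set P : ψ.GNS →L[ℂ] ψ.GNS := (1 / 2 : ℂ) • (1 + parityOp ψ θ h) with hP
  have hstar : star P = P := by
    rw [hP, star_smul, star_add, star_one, star_parityOp ψ θ h hθ]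
    simp
  have hPJ (v) : P (J v) = J v := by
    rw [hP, smul_apply, add_apply, one_apply_eq_self, parityOp_evenIsometry, ← two_smul ℂ,
      smul_smul]
    norm_num
  have hJP (v) : adjoint J.toContinuousLinearMap (P v) = adjoint J.toContinuousLinearMap v := by
    refine ext_inner_right ℂ fun w => ?_
    rw [ContinuousLinearMap.adjoint_inner_left, ContinuousLinearMap.adjoint_inner_left,
      ← hstar, ContinuousLinearMap.star_eq_adjoint, ContinuousLinearMap.adjoint_inner_left]
    exact congrArg _ (hPJ w)
  refine gns_ext ψ fun a => ?_
  have hPa : P (ψ.toPreGNS a : ψ.PreGNS) =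
      J ((EvenPart.restrict θ ψ).toPreGNS (evenElem hθ a) : (EvenPart.restrict θ ψ).PreGNS) := by
    rw [evenIsometry_coe, incl_evenElem, map_smul, map_add, UniformSpace.Completion.coe_smul,
      UniformSpace.Completion.coe_add, ← parityOp_coe ψ θ h]
    rfl
  rw [cornerHom_apply_apply, one_apply_eq_self, ← hJP, hPa, adjoint_apply_apply]

include hθ in
lemma commute_parityOp {x : ψ.GNS →L[ℂ] ψ.GNS}
    (hx : Commute (cornerHom (evenIsometry ψ θ) 1) x) : Commute (parityOp ψ θ h) x := by
  have hΓ : parityOp ψ θ h = (2 : ℂ) • cornerHom (evenIsometry ψ θ) 1 - 1 := by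
    rw [cornerHom_evenIsometry_one h hθ]; module
  rw [hΓ]
  exact (hx.smul_left _).sub_left (Commute.one_left x)

include hθ in
lemma parityOp_mul_gns_mul_parityOp (a : A) :
    parityOp ψ θ h * ψ.gnsStarAlgHom a * parityOp ψ θ h = ψ.gnsStarAlgHom (θ a) := by
  rw [parityOp_mul_gns, mul_assoc, parityOp_mul_self ψ θ h hθ, mul_one]

include h in
lemma evenPart_gns (a : A) :
    evenPart (cornerHom (evenIsometry ψ θ) 1) (ψ.gnsStarAlgHom a) =
      ψ.gnsStarAlgHom (EvenPart.incl θ (evenElem hθ a)) := by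
  rw [cornerHom_evenIsometry_one h hθ, evenPart, incl_evenElem, map_smul, map_add,
    ← parityOp_mul_gns_mul_parityOp h hθ]
  simp only [smul_add, add_mul, mul_add, sub_mul, mul_sub, smul_mul_assoc, mul_smul_comm, one_mul,
    mul_one]
  module

include h hθ in
lemma commute_evenProjection_gns_incl (a : EvenPart θ) :
    Commute (cornerHom (evenIsometry ψ θ) 1) (ψ.gnsStarAlgHom (EvenPart.incl θ a)) := by
  have hΓ : Commute (parityOp ψ θ h) (ψ.gnsStarAlgHom (EvenPart.incl θ a)) := by
    rw [commute_iff_eq, parityOp_mul_gns, map_incl]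
  rw [cornerHom_evenIsometry_one h hθ]
  exact ((Commute.one_left _).add_left hΓ).smul_left _

include h hθ in
lemma cornerHom_gns (a : EvenPart θ) :
    cornerHom (evenIsometry ψ θ) ((EvenPart.restrict θ ψ).gnsStarAlgHom a) =
      cornerHom (evenIsometry ψ θ) 1 * ψ.gnsStarAlgHom (EvenPart.incl θ a) := by
  rw [(commute_evenProjection_gns_incl h hθ a).eq]
  ext v
  exact (gns_incl_evenIsometry ψ a _).symm

include h hθ in
lemma isOddInvolution_gns {u : A} (huu : u * u = 1) (hu : θ u = -u) :
    IsOddInvolution (cornerHom (evenIsometry ψ θ) 1) (ψ.gnsStarAlgHom u) where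
  mul_self := by rw [← map_mul, huu, map_one]
  mul_eq := by
    have hanti := parityOp_mul_gns ψ θ h u
    rw [hu, map_neg, neg_mul] at hanti
    rw [cornerHom_evenIsometry_one h hθ, smul_mul_assoc, add_mul, hanti, mul_sub, mul_smul_comm,
      mul_add, one_mul, mul_one]
    module

variable {B : StarSubalgebra ℂ A} (hB : ∀ b ∈ B, θ b ∈ B)

include hB in
lemma incl_evenElem_mem {b : A} (hb : b ∈ B) : EvenPart.incl θ (evenElem hθ b) ∈ B :=
  B.smul_mem (add_mem hb (hB b hb)) _

include h hθ hB in
lemma isGraded_gns_image (hodd : ∃ u ∈ B, u * u = 1 ∧ θ u = -u) :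
    IsGraded (cornerHom (evenIsometry ψ θ) 1) (ψ.gnsStarAlgHom '' B) where
  mul_mem := by
    rintro _ ⟨a, ha, rfl⟩ _ ⟨b, hb, rfl⟩
    exact ⟨a * b, mul_mem ha hb, map_mul _ a b⟩
  evenPart_mem := by
    rintro _ ⟨a, ha, rfl⟩
    exact ⟨_, incl_evenElem_mem hθ hB ha, (evenPart_gns h hθ a).symm⟩
  exists_odd := by
    obtain ⟨u, huB, huu, hu⟩ := hodd
    exact ⟨_, ⟨u, huB, rfl⟩, isOddInvolution_gns h hθ huu hu⟩

include h hθ hB in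
lemma evenCompression_gns_image :
    evenCompression (cornerHom (evenIsometry ψ θ)) (ψ.gnsStarAlgHom '' B) =
      (EvenPart.restrict θ ψ).gnsStarAlgHom '' EvenPart.localPart θ B := by
  have hp := isIdempotentElem_map_one (cornerHom (evenIsometry ψ θ))
  ext x
  constructor
  · rintro ⟨_, ⟨b, hb, rfl⟩, hpb, hx⟩
    refine ⟨evenElem hθ b, incl_evenElem_mem hθ hB hb,
      (isCornerEmbedding_cornerHom (evenIsometry ψ θ)).injective ?_⟩
    rw [cornerHom_gns h hθ, ← evenPart_gns h hθ, evenPart_eq_self hp hpb, hx]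
  · rintro ⟨a, ha, rfl⟩
    exact ⟨_, ⟨_, ha, rfl⟩, commute_evenProjection_gns_incl h hθ a, cornerHom_gns h hθ a⟩

end EvenGNS

section Pure

open scoped InnerProductSpace

variable {A : Type*} [CStarAlgebra A] [PartialOrder A] [StarOrderedRing A] {ψ : A →ₚ[ℂ] ℂ}
  {R S : ψ.GNS →L[ℂ] ψ.GNS}

/-- The commutant `π(A)'` of the GNS representation. -/
def gnsCommutant (ψ : A →ₚ[ℂ] ℂ) : StarSubalgebra ℂ (ψ.GNS →L[ℂ] ψ.GNS) :=
  StarSubalgebra.centralizer ℂ (Set.range ψ.gnsStarAlgHom)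

lemma mem_gnsCommutant_iff :
    R ∈ gnsCommutant ψ ↔ R ∈ (Set.range ψ.gnsStarAlgHom).centralizer := by
  rw [gnsCommutant, ← SetLike.mem_coe, StarSubalgebra.coe_centralizer, Set.union_eq_left.2]
  rintro x ⟨a, ha⟩
  exact ⟨star a, by rw [map_star, ha, star_star]⟩

/-- The functional `a ↦ ⟪Ω, R π(a) Ω⟫_ℂ`, where `Ω` is the GNS vector. For `R` in the commutant of
`π` these are the functionals dominated by a multiple of `ψ`. -/
def gnsFunctional (ψ : A →ₚ[ℂ] ℂ) (R : ψ.GNS →L[ℂ] ψ.GNS) : A →ₗ[ℂ] ℂ where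
  toFun a := ⟪gnsVector ψ, R (ψ.gnsStarAlgHom a (gnsVector ψ))⟫_ℂ
  map_add' a b := by simp [inner_add_right]
  map_smul' z a := by simp [inner_smul_right]

lemma gnsFunctional_apply (a : A) :
    gnsFunctional ψ R a = ⟪gnsVector ψ, R (ψ.gnsStarAlgHom a (gnsVector ψ))⟫_ℂ := rfl

lemma gns_gnsVector (a : A) : ψ.gnsStarAlgHom a (gnsVector ψ) = (ψ.toPreGNS a : ψ.PreGNS) := by
  rw [gnsVector, gns_coe, mul_one]

lemma gnsFunctional_one : gnsFunctional ψ 1 = ψ.toLinearMap := by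
  ext a
  rw [gnsFunctional_apply, one_apply_eq_self, gns_gnsVector, gnsVector,
    UniformSpace.Completion.inner_coe, PositiveLinearMap.preGNS_inner_def]
  simp

lemma gnsFunctional_star_mul (hR : R ∈ gnsCommutant ψ) (a b : A) :
    gnsFunctional ψ R (star a * b) =
      ⟪((ψ.toPreGNS a : ψ.PreGNS) : ψ.GNS), R (ψ.toPreGNS b : ψ.PreGNS)⟫_ℂ := by
  have hcomm (v) : R (ψ.gnsStarAlgHom (star a) v) = ψ.gnsStarAlgHom (star a) (R v) :=
    DFunLike.congr_fun (mem_gnsCommutant_iff.1 hR _ ⟨star a, rfl⟩).symm v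
  rw [gnsFunctional_apply, map_mul, mul_apply_eq_comp, gns_gnsVector, hcomm, map_star,
    ContinuousLinearMap.star_eq_adjoint, ContinuousLinearMap.adjoint_inner_right, gns_gnsVector]

lemma eq_of_gnsFunctional_eq (hR : R ∈ gnsCommutant ψ)
    (hS : S ∈ gnsCommutant ψ)
    (hRS : gnsFunctional ψ R = gnsFunctional ψ S) : R = S := by
  refine gns_ext ψ fun b => ext_inner_left ℂ fun v => ?_
  induction v using UniformSpace.Completion.induction_on with
  | hp => exact isClosed_eq (by fun_prop) (by fun_prop)
  | ih v =>
    obtain ⟨a, rfl⟩ := ψ.toPreGNS.surjective v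
    rw [← gnsFunctional_star_mul hR, ← gnsFunctional_star_mul hS, hRS]

lemma gnsFunctional_mem_stateSpace (hR : R ∈ gnsCommutant ψ)
    (hpos : 0 ≤ R) (hone : ⟪gnsVector ψ, R (gnsVector ψ)⟫_ℂ = 1) :
    gnsFunctional ψ R ∈ stateSpace A := by
  refine ⟨fun a => ?_, by rwa [gnsFunctional_apply, map_one, one_apply_eq_self]⟩
  rw [gnsFunctional_star_mul hR]
  exact ((ContinuousLinearMap.nonneg_iff_isPositive R).1 hpos).inner_nonneg_right _

lemma IsPureState.norm_gnsVector (hψ : IsPureState ψ) : ‖gnsVector ψ‖ = 1 := by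
  have h : ⟪gnsVector ψ, gnsVector ψ⟫_ℂ = 1 := by
    rw [← hψ.1.2, ← gnsFunctional_one, gnsFunctional_apply, map_one]
    rfl
  refine (pow_eq_one_iff_of_nonneg (norm_nonneg _) two_ne_zero).1 ?_
  rw [← inner_self_eq_norm_sq (𝕜 := ℂ), h, RCLike.one_re]

/-- `ψ` is the midpoint of the states given by `1 + S` and `1 - S`. -/
lemma IsPureState.eq_zero_of_bounds (hψ : IsPureState ψ)
    (hS : S ∈ gnsCommutant ψ) (hle : S ≤ 1) (hge : -1 ≤ S)
    (hzero : ⟪gnsVector ψ, S (gnsVector ψ)⟫_ℂ = 0) : S = 0 := by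
  have hadd := add_mem (one_mem (gnsCommutant ψ)) hS
  have hsub := sub_mem (one_mem (gnsCommutant ψ)) hS
  have hmem : ψ.toLinearMap ∈
      openSegment ℝ (gnsFunctional ψ (1 + S)) (gnsFunctional ψ (1 - S)) := by
    refine ⟨1 / 2, 1 / 2, by norm_num, by norm_num, by norm_num, ?_⟩
    ext a
    rw [← gnsFunctional_one]
    simp [gnsFunctional_apply, inner_add_right, inner_sub_right]
    ring
  have heq := hψ.2 (gnsFunctional_mem_stateSpace hadd (neg_le_iff_add_nonneg'.1 hge) ?_)
    (gnsFunctional_mem_stateSpace hsub (sub_nonneg.2 hle) ?_) hmem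
  · rw [← gnsFunctional_one] at heq
    simpa using eq_of_gnsFunctional_eq hadd (one_mem _) heq
  · simp [inner_add_right, hψ.norm_gnsVector, hzero]
  · simp [inner_sub_right, hψ.norm_gnsVector, hzero]

lemma IsPureState.eq_zero_of_isSelfAdjoint (hψ : IsPureState ψ) (hS : S ∈ gnsCommutant ψ)
    (hsa : IsSelfAdjoint S) (hzero : ⟪gnsVector ψ, S (gnsVector ψ)⟫_ℂ = 0) : S = 0 := by
  by_contra hne
  set T := (‖S‖⁻¹ : ℂ) • S with hT
  have hsaT : IsSelfAdjoint T := by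
    refine IsSelfAdjoint.smul ?_ hsa
    simp [isSelfAdjoint_iff]
  have hnorm : ‖T‖ = 1 := norm_smul_inv_norm hne
  have hT0 : T = 0 := by
    refine hψ.eq_zero_of_bounds ((gnsCommutant ψ).smul_mem hS _) ?_ ?_ ?_
    · simpa [hnorm] using hsaT.le_algebraMap_norm_self
    · simpa [hnorm] using hsaT.neg_algebraMap_norm_le_self
    · rw [hT, smul_apply, inner_smul_right, hzero, mul_zero]
  simp [hT0] at hnorm

lemma IsPureState.mem_center_of_isSelfAdjoint (hψ : IsPureState ψ) (hS : S ∈ gnsCommutant ψ)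
    (hsa : IsSelfAdjoint S) : S ∈ Set.center (ψ.GNS →L[ℂ] ψ.GNS) := by
  set z : ℂ := ⟪gnsVector ψ, S (gnsVector ψ)⟫_ℂ with hz
  have hzsa : IsSelfAdjoint z := by
    rw [isSelfAdjoint_iff, hz, ← starRingEnd_apply, inner_conj_symm,
      ← ContinuousLinearMap.adjoint_inner_right, ← ContinuousLinearMap.star_eq_adjoint, hsa.star_eq]
  have hSz : S - algebraMap ℂ _ z = 0 := by
    refine hψ.eq_zero_of_isSelfAdjoint (sub_mem hS (algebraMap_mem _ z))
      (hsa.sub (hzsa.algebraMap _)) ?_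
    simp [Algebra.algebraMap_eq_smul_one, inner_sub_right, inner_smul_right,
      hψ.norm_gnsVector, hz]
  rw [sub_eq_zero.1 hSz]
  exact Set.algebraMap_mem_center z

open scoped ComplexStarModule in
theorem IsPureState.centralizer_range_subset_center (hψ : IsPureState ψ) :
    (Set.range ψ.gnsStarAlgHom).centralizer ⊆ Set.center (ψ.GNS →L[ℂ] ψ.GNS) := by
  intro R hR
  have hR := mem_gnsCommutant_iff.2 hR
  have hstar := star_mem hR
  have hre : (ℜ R : ψ.GNS →L[ℂ] ψ.GNS) ∈ gnsCommutant ψ := by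
    rw [realPart_apply_coe, ← Complex.coe_smul]
    exact (gnsCommutant ψ).smul_mem (add_mem hR hstar) _
  have him : (ℑ R : ψ.GNS →L[ℂ] ψ.GNS) ∈ gnsCommutant ψ := by
    rw [imaginaryPart_apply_coe, ← Complex.coe_smul]
    exact (gnsCommutant ψ).smul_mem ((gnsCommutant ψ).smul_mem (sub_mem hR hstar) _) _
  rw [← realPart_add_I_smul_imaginaryPart R]
  exact Set.add_mem_center (hψ.mem_center_of_isSelfAdjoint hre (ℜ R).2)
    (Set.smul_mem_center _ (hψ.mem_center_of_isSelfAdjoint him (ℑ R).2))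

end Pure

section Net

variable {ι A : Type*} [CStarAlgebra A] {θ : A →⋆ₐ[ℂ] A} {𝓐 : Set ι → StarSubalgebra ℂ A}

/-- A family of local algebras, indexed by the subsets of a set of sites, that is graded by the
involution `θ`: each local algebra is `θ`-stable, and each nontrivial one has an odd element which
squares to `1`. -/
structure IsGradedNet (θ : A →⋆ₐ[ℂ] A) (𝓐 : Set ι → StarSubalgebra ℂ A) : Prop where
  involutive : ∀ a, θ (θ a) = a
  empty : 𝓐 ∅ = ⊥
  univ : 𝓐 Set.univ = ⊤
  map_mem : ∀ Λ, ∀ a ∈ 𝓐 Λ, θ a ∈ 𝓐 Λ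
  exists_odd : ∀ Λ : Set ι, Λ.Nonempty → ∃ u ∈ 𝓐 Λ, u * u = 1 ∧ θ u = -u

variable [PartialOrder A] [StarOrderedRing A] {ψ : A →ₚ[ℂ] ℂ} {Λ : Set ι}

lemma gns_image_bot_subset_center :
    ψ.gnsStarAlgHom '' ((⊥ : StarSubalgebra ℂ A) : Set A) ⊆ Set.center (ψ.GNS →L[ℂ] ψ.GNS) := by
  rintro _ ⟨a, ha, rfl⟩
  obtain ⟨z, rfl⟩ := StarSubalgebra.mem_bot.1 ha
  rw [AlgHomClass.commutes]
  exact Set.algebraMap_mem_center z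

lemma IsPureState.centralizer_gns_image_top_subset_center (hψ : IsPureState ψ) :
    (ψ.gnsStarAlgHom '' ((⊤ : StarSubalgebra ℂ A) : Set A)).centralizer ⊆
      Set.center (ψ.GNS →L[ℂ] ψ.GNS) := by
  rw [StarSubalgebra.coe_top, Set.image_univ]
  exact hψ.centralizer_range_subset_center

theorem IsGradedNet.duality_iff [Nonempty ι] (h𝓐 : IsGradedNet θ 𝓐) (h : ∀ a, ψ (θ a) = ψ a)
    {e : (ψ.GNS →L[ℂ] ψ.GNS) ≃+* (ψ.GNS →L[ℂ] ψ.GNS)}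
    (he : ∀ x, Commute (parityOp ψ θ h) x → e x = x)
    (hcomm : ψ.gnsStarAlgHom '' 𝓐 Λ ⊆ (e '' (ψ.gnsStarAlgHom '' 𝓐 Λᶜ)).centralizer)
    (hΛ : IsPureState ψ ∨ Λ.Nonempty ∧ Λᶜ.Nonempty) :
    (ψ.gnsStarAlgHom '' 𝓐 Λ).centralizer.centralizer =
        (e '' (ψ.gnsStarAlgHom '' 𝓐 Λᶜ)).centralizer ↔
      ((EvenPart.restrict θ ψ).gnsStarAlgHom ''
          EvenPart.localPart θ (𝓐 Λ)).centralizer.centralizer =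
        ((EvenPart.restrict θ ψ).gnsStarAlgHom '' EvenPart.localPart θ (𝓐 Λᶜ)).centralizer := by
  have hj := isCornerEmbedding_cornerHom (evenIsometry ψ θ)
  have fixes_even (x) (hx : Commute (cornerHom (evenIsometry ψ θ) 1) x) : e x = x :=
    he x (commute_parityOp h h𝓐.involutive hx)
  have graded {Λ : Set ι} (hΛ : Λ.Nonempty) :=
    isGraded_gns_image h h𝓐.involutive (h𝓐.map_mem Λ) (h𝓐.exists_odd Λ hΛ)
  rw [← evenCompression_gns_image h h𝓐.involutive (h𝓐.map_mem Λ),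
    ← evenCompression_gns_image h h𝓐.involutive (h𝓐.map_mem Λᶜ),
    ← evenCompression_image fixes_even (ψ.gnsStarAlgHom '' 𝓐 Λᶜ)]
  rcases Λ.eq_empty_or_nonempty with rfl | hΛ₀
  · have hψ := hΛ.resolve_right fun hΛ => hΛ.1.ne_empty rfl
    rw [Set.compl_empty] at hcomm ⊢
    refine ((graded Set.univ_nonempty).image fixes_even).duality_iff_of_left_subset_center hj ?_ ?_
    · rw [h𝓐.empty]; exact gns_image_bot_subset_center
    · rw [h𝓐.univ]
      exact centralizer_image_subset_center e hψ.centralizer_gns_image_top_subset_center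
  rcases Λᶜ.eq_empty_or_nonempty with hc | hΛc
  · have hψ := hΛ.resolve_right fun hΛ => hΛ.2.ne_empty hc
    rw [hc]
    refine (graded hΛ₀).duality_iff_of_right_subset_center hj ?_ ?_
    · rw [Set.compl_empty_iff.1 hc, h𝓐.univ]; exact hψ.centralizer_gns_image_top_subset_center
    · rw [h𝓐.empty]; exact image_subset_center e gns_image_bot_subset_center
  · exact (graded hΛ₀).duality_iff hj ((graded hΛc).image fixes_even) hcomm

end Net

section Generated

open scoped CStarAlgebra

variable {A B : Type*} [CStarAlgebra A] [CStarAlgebra B]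

lemma cstarGen_le {s : Set B} {S : StarSubalgebra ℂ B} (hS : IsClosed (S : Set B)) (h : s ⊆ S) :
    cstarGen s ≤ S :=
  StarSubalgebra.topologicalClosure_minimal (StarAlgebra.adjoin_le h) hS

lemma cstarGen_empty : cstarGen (∅ : Set B) = ⊥ := by
  refine le_antisymm (cstarGen_le ?_ (Set.empty_subset _)) bot_le
  have h : ((⊥ : StarSubalgebra ℂ B) : Set B) = (Submodule.span ℂ {(1 : B)} : Submodule ℂ B) := by
    ext x
    simp [Submodule.mem_span_singleton, Algebra.algebraMap_eq_smul_one]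
  rw [h]
  exact Submodule.closed_of_finiteDimensional _

lemma commute_map_of_mem_cstarGen (ρ : A →⋆ₐ[ℂ] B) {s : Set A} {x : B}
    (h : ∀ a ∈ s, Commute x (ρ a) ∧ Commute x (star (ρ a))) {a : A} (ha : a ∈ cstarGen s) :
    Commute x (ρ a) := by
  have hle : cstarGen s ≤ (StarSubalgebra.centralizer ℂ {x}).comap ρ := by
    refine cstarGen_le ?_ fun a ha => ?_
    · rw [StarSubalgebra.coe_comap, StarSubalgebra.coe_centralizer]
      exact (Set.isClosed_centralizer _).preimage (map_continuous ρ)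
    · refine (StarSubalgebra.mem_centralizer_iff ℂ).2 ?_
      rintro _ rfl
      exact ⟨(h a ha).1.eq, (h a ha).2.star_left.eq⟩
  exact ((StarSubalgebra.mem_centralizer_iff ℂ).1 (hle ha) x rfl).1

lemma image_cstarGen_subset_centralizer {A₁ A₂ : Type*} [CStarAlgebra A₁] [CStarAlgebra A₂]
    (ρ₁ : A₁ →⋆ₐ[ℂ] B) (ρ₂ : A₂ →⋆ₐ[ℂ] B) {s₁ : Set A₁} {s₂ : Set A₂}
    (h : ∀ a ∈ s₁, ∀ b ∈ s₂, Commute (ρ₁ a) (ρ₂ b) ∧ Commute (ρ₁ a) (star (ρ₂ b))) :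
    ρ₁ '' cstarGen s₁ ⊆ (ρ₂ '' cstarGen s₂).centralizer := by
  rintro _ ⟨a, ha, rfl⟩ _ ⟨b, hb, rfl⟩
  have left {a : A₁} (ha : a ∈ s₁) {b : A₂} (hb : b ∈ cstarGen s₂) : Commute (ρ₂ b) (ρ₁ a) :=
    (commute_map_of_mem_cstarGen ρ₂ (h a ha) hb).symm
  refine (commute_map_of_mem_cstarGen ρ₁ (fun a ha => ⟨left ha hb, ?_⟩) ha).eq
  have hstar := left ha (star_mem hb)
  rw [map_star] at hstar
  exact hstar.star_right

lemma cstarGen_eq_top {s : Set B} {t : Set A} (ρ : A →⋆ₐ[ℂ] B) (hρ : Isometry ρ)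
    (hrange : ∀ a, ρ a ∈ cstarGen s) (hst : s ⊆ ρ '' t) : cstarGen t = ⊤ := by
  have hle : cstarGen s ≤ (cstarGen t).map ρ := by
    refine cstarGen_le ?_ ?_ <;> rw [StarSubalgebra.coe_map]
    · exact hρ.isClosedEmbedding.isClosedMap _ (isClosed_cstarGen t)
    · exact hst.trans (Set.image_mono (subset_cstarGen t))
  refine eq_top_iff.2 fun a _ => ?_
  obtain ⟨b, hb, hab⟩ := hle (hrange a)
  rwa [← hρ.injective hab]

end Generated

namespace CAR

lemma gaugeUnitary_add (s t : ℝ) : gaugeUnitary (s + t) = gaugeUnitary s * gaugeUnitary t := by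
  refine Subtype.ext (ContinuousLinearMap.ext fun ξ => lp.ext (funext fun G => ?_))
  change (Circle.exp (s + t) : ℂ) ^ G.card * ξ G =
    (Circle.exp s : ℂ) ^ G.card * ((Circle.exp t : ℂ) ^ G.card * ξ G)
  rw [Circle.exp_add, Circle.coe_mul, mul_pow, mul_assoc]

lemma gauge_gauge (s t : ℝ) (a : CAR) : gauge s (gauge t a) = gauge (s + t) a := by
  refine Subtype.ext ?_
  change gaugeConj s (gaugeConj t a.1) = gaugeConj (s + t) a.1
  rw [gaugeConj, gaugeConj, gaugeConj, gaugeUnitary_add, conjHom, conjHom, conjHom, map_mul]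
  rfl

lemma gauge_zero (a : CAR) : gauge 0 a = a := by
  have hone : gaugeUnitary 0 = 1 := by
    rw [← mul_eq_left (a := gaugeUnitary 0), ← gaugeUnitary_add, add_zero]
  refine Subtype.ext ?_
  change gaugeConj 0 a.1 = a.1
  rw [gaugeConj, hone, conjHom, map_one]
  rfl

lemma gauge_mem_localAlg (t : ℝ) (Λ : Set ℤ) {a : CAR} (ha : a ∈ localAlg Λ) :
    gauge t a ∈ localAlg Λ := by
  refine map_mem_cstarGen _ (gauge t) (map_continuous (gauge t)) ?_ ha
  rintro _ ⟨j, hj, rfl⟩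
  rw [gauge_c]
  exact SMulMemClass.smul_mem _ (subset_cstarGen _ ⟨j, hj, rfl⟩)

lemma gauge_image_localAlg (t : ℝ) (Λ : Set ℤ) :
    gauge t '' (localAlg Λ : Set CAR) = localAlg Λ := by
  refine (Set.image_subset_iff.2 fun a => gauge_mem_localAlg t Λ).antisymm fun a ha => ?_
  exact ⟨gauge (-t) a, gauge_mem_localAlg _ Λ ha, by
    rw [gauge_gauge, add_neg_cancel, gauge_zero]⟩

lemma localAlg_empty : localAlg ∅ = ⊥ := by
  rw [localAlg, Set.image_empty, cstarGen_empty]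

lemma localAlg_univ : localAlg Set.univ = ⊤ := by
  refine cstarGen_eq_top (s := Set.range annihilate)
    ((cstarGen (Set.range annihilate)).subtype : CAR →⋆ₐ[ℂ] (Fock →L[ℂ] Fock))
    isometry_subtype_coe (fun a => a.2) ?_
  rintro _ ⟨j, rfl⟩
  exact ⟨c j, ⟨j, Set.mem_univ j, rfl⟩, rfl⟩

lemma c_mul_self (j : ℤ) : c j * c j = 0 := by
  have h := c_anticomm j j
  rwa [← two_smul ℂ, smul_eq_zero_iff_right two_ne_zero] at h

lemma add_star_c_mul_self (j : ℤ) : (c j + star (c j)) * (c j + star (c j)) = 1 := by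
  have hstar : star (c j) * star (c j) = 0 := by rw [← star_mul, c_mul_self, star_zero]
  have h := c_anticomm_star j j
  rw [if_pos rfl] at h
  rw [add_mul, mul_add, mul_add, c_mul_self, hstar, zero_add, add_zero, h]

lemma isGradedNet_localAlg : IsGradedNet Θ localAlg where
  involutive := Θ_Θ
  empty := localAlg_empty
  univ := localAlg_univ
  map_mem Λ _ := gauge_mem_localAlg _ Λ
  exists_odd := by
    rintro Λ ⟨j, hj⟩
    have hc : c j ∈ localAlg Λ := subset_cstarGen _ ⟨j, hj, rfl⟩
    refine ⟨c j + star (c j), add_mem hc (star_mem hc), add_star_c_mul_self j, ?_⟩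
    rw [map_add, map_star, Θ_c, star_neg, neg_add]

variable (ψ : CAR →ₚ[ℂ] ℂ) (h : ∀ a, ψ (Θ a) = ψ a)

/-- Conjugation by the unitary `e^{iπΓ/4}`. -/
def twist : (ψ.GNS →L[ℂ] ψ.GNS) ≃+* (ψ.GNS →L[ℂ] ψ.GNS) :=
  RingEquivClass.toRingEquiv (Unitary.conjStarAlgAut ℂ _ (twistUnitary ψ h))

lemma twist_apply (x : ψ.GNS →L[ℂ] ψ.GNS) :
    twist ψ h x = twistUnitary ψ h * x * star (twistUnitary ψ h : ψ.GNS →L[ℂ] ψ.GNS) := rfl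

lemma twist_eq_self (x : ψ.GNS →L[ℂ] ψ.GNS) (hx : Commute (parityOp ψ Θ h) x) :
    twist ψ h x = x := by
  have hcomm : Commute (twistUnitary ψ h : ψ.GNS →L[ℂ] ψ.GNS) x :=
    ((Commute.one_left x).add_left (hx.smul_left _)).smul_left _
  rw [twist_apply, hcomm.eq, mul_assoc, Unitary.mul_star_self_of_mem (twistUnitary ψ h).2, mul_one]

lemma twistedRep_image_localAlg (Λ : Set ℤ) :
    twistedRep ψ h '' localAlg Λ = twist ψ h '' (ψ.gnsStarAlgHom '' localAlg Λ) := by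
  conv_rhs => rw [← gauge_image_localAlg (-(Real.pi / 2)), Set.image_image, Set.image_image]
  rfl

lemma Γ_mul_gns_c (j : ℤ) : Γ ψ h * ψ.gnsStarAlgHom (c j) = -(ψ.gnsStarAlgHom (c j) * Γ ψ h) := by
  rw [Γ_mul_gns, Θ_c, map_neg, neg_mul]

lemma commute_gns_c_twistedRep_c (j k : ℤ) :
    Commute (ψ.gnsStarAlgHom (c j)) (twistedRep ψ h (c k)) := by
  have hanti : c k * c j = -(c j * c k) := eq_neg_of_add_eq_zero_right (c_anticomm j k)
  rw [twistedRep_c, commute_iff_eq, mul_assoc, Γ_mul_gns_c, mul_neg, ← mul_assoc, ← map_mul,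
    ← mul_assoc, ← map_mul, hanti, map_neg, neg_mul, neg_neg]

lemma commute_gns_c_star_twistedRep_c {j k : ℤ} (hjk : j ≠ k) :
    Commute (ψ.gnsStarAlgHom (c j)) (star (twistedRep ψ h (c k))) := by
  have hanti : star (c k) * c j = -(c j * star (c k)) :=
    eq_neg_of_add_eq_zero_right ((c_anticomm_star j k).trans (if_neg hjk))
  rw [← map_star, twistedRep_star_c, commute_iff_eq, mul_assoc, ← map_mul, hanti, map_neg, mul_neg,
    map_mul, ← mul_assoc, ← mul_assoc, Γ_mul_gns_c, neg_mul, neg_neg]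

lemma gns_localAlg_subset_centralizer_twistedRep (Λ : Set ℤ) :
    ψ.gnsStarAlgHom '' localAlg Λ ⊆ (twistedRep ψ h '' localAlg Λᶜ).centralizer := by
  refine image_cstarGen_subset_centralizer ψ.gnsStarAlgHom (twistedRep ψ h) ?_
  rintro _ ⟨j, hj, rfl⟩ _ ⟨k, hk, rfl⟩
  exact ⟨commute_gns_c_twistedRep_c ψ h j k,
    commute_gns_c_star_twistedRep_c ψ h fun hjk => hk (hjk ▸ hj)⟩

theorem twistedHaagDuality_iff {Λ : Set ℤ} (hΛ : IsPureState ψ ∨ Λ.Nonempty ∧ Λᶜ.Nonempty) :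
    TwistedHaagDuality ψ h Λ ↔ EvenHaagDuality ψ Λ := by
  have hcomm := gns_localAlg_subset_centralizer_twistedRep ψ h Λ
  rw [TwistedHaagDuality, EvenHaagDuality, twistedRep_image_localAlg]
  rw [twistedRep_image_localAlg] at hcomm
  exact isGradedNet_localAlg.duality_iff h (twist_eq_self ψ h) hcomm hΛ

end CAR

namespace Spin

lemma Θ_site (j : ℤ) (Q : Matrix (Fin 2) (Fin 2) ℂ) :
    Θ (site j Q) = site j (Matrix.of fun a b => (if a = b then 1 else -1) * Q a b) :=
  Subtype.ext (gaugeConj_siteOp j Q)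

lemma Θ_mem_localAlg (Λ : Set ℤ) {a : Spin} (ha : a ∈ localAlg Λ) : Θ a ∈ localAlg Λ := by
  refine map_mem_cstarGen _ Θ (map_continuous Θ) ?_ ha
  rintro _ ⟨j, hj, Q, rfl⟩
  rw [Θ_site]
  exact subset_cstarGen _ ⟨j, hj, _, rfl⟩

lemma localAlg_empty : localAlg ∅ = ⊥ := by
  rw [localAlg, ← cstarGen_empty]
  congr 1
  ext x
  simp

lemma localAlg_univ : localAlg Set.univ = ⊤ := by
  refine cstarGen_eq_top (s := Set.range fun x : ℤ × Matrix (Fin 2) (Fin 2) ℂ => siteOp x.1 x.2)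
    ((cstarGen (Set.range fun x : ℤ × Matrix (Fin 2) (Fin 2) ℂ => siteOp x.1 x.2)).subtype :
      Spin →⋆ₐ[ℂ] (Fock →L[ℂ] Fock))
    isometry_subtype_coe (fun a => a.2) ?_
  rintro _ ⟨⟨j, Q⟩, rfl⟩
  exact ⟨site j Q, ⟨j, Set.mem_univ j, Q, rfl⟩, rfl⟩

lemma isGradedNet_localAlg : IsGradedNet Θ localAlg where
  involutive _ := Subtype.ext (gaugeConj_pi_pi _)
  empty := localAlg_empty
  univ := localAlg_univ
  map_mem Λ _ := Θ_mem_localAlg Λ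
  exists_odd := by
    rintro Λ ⟨j, hj⟩
    refine ⟨site j !![0, 1; 1, 0], subset_cstarGen _ ⟨j, hj, _, rfl⟩, ?_, (Θ_pauli j).1⟩
    have hsq : !![0, 1; 1, 0] * !![0, 1; 1, 0] = (1 : Matrix (Fin 2) (Fin 2) ℂ) := by
      simp [Matrix.one_fin_two]
    rw [← site_mul, hsq, site_one]

variable (φ : Spin →ₚ[ℂ] ℂ)

lemma gns_localAlg_subset_centralizer (Λ : Set ℤ) :
    φ.gnsStarAlgHom '' localAlg Λ ⊆ (φ.gnsStarAlgHom '' localAlg Λᶜ).centralizer := by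
  refine image_cstarGen_subset_centralizer φ.gnsStarAlgHom φ.gnsStarAlgHom ?_
  rintro _ ⟨j, hj, P, rfl⟩ _ ⟨k, hk, Q, rfl⟩
  have hjk : j ≠ k := fun hjk => hk (hjk ▸ hj)
  have hcomm (Q) : Commute (site j P) (site k Q) := site_commute hjk P Q
  rw [← map_star, ← site_star]
  exact ⟨(hcomm Q).map φ.gnsStarAlgHom, (hcomm (star Q)).map φ.gnsStarAlgHom⟩

theorem haagDuality_iff (h : ∀ a, φ (Θ a) = φ a) {Λ : Set ℤ}
    (hΛ : IsPureState φ ∨ Λ.Nonempty ∧ Λᶜ.Nonempty) :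
    HaagDuality φ Λ ↔ EvenHaagDuality φ Λ := by
  have hrefl : RingEquiv.refl _ '' (φ.gnsStarAlgHom '' localAlg Λᶜ) =
      φ.gnsStarAlgHom '' localAlg Λᶜ := Set.image_id _
  have hiff := isGradedNet_localAlg.duality_iff h (e := RingEquiv.refl _) (fun _ _ => rfl)
    (by rw [hrefl]; exact gns_localAlg_subset_centralizer φ Λ) hΛ
  rwa [hrefl] at hiff

end Spin

end TwistedDuality

end

theorem mainTheorem8_general :
    (∀ (ψ : TwistedDuality.CAR →ₚ[ℂ] ℂ) (hΘ : ∀ a, ψ (TwistedDuality.CAR.Θ a) = ψ a) (Λ : Set ℤ),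
      TwistedDuality.IsPureState ψ ∨ Λ.Nonempty ∧ Λᶜ.Nonempty →
        (TwistedDuality.CAR.TwistedHaagDuality ψ hΘ Λ ↔
          TwistedDuality.CAR.EvenHaagDuality ψ Λ)) ∧
    (∀ (φ : TwistedDuality.Spin →ₚ[ℂ] ℂ), (∀ a, φ (TwistedDuality.Spin.Θ a) = φ a) →
      ∀ (Λ : Set ℤ), TwistedDuality.IsPureState φ ∨ Λ.Nonempty ∧ Λᶜ.Nonempty →
        (TwistedDuality.Spin.HaagDuality φ Λ ↔
          TwistedDuality.Spin.EvenHaagDuality φ Λ)) :=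
  ⟨fun ψ hΘ _ hΛ => TwistedDuality.CAR.twistedHaagDuality_iff ψ hΘ hΛ,
    fun φ hΘ _ hΛ => TwistedDuality.Spin.haagDuality_iff φ hΘ hΛ⟩

theorem mainTheorem8 :
    (∀ (ψ : TwistedDuality.CAR →ₚ[ℂ] ℂ), TwistedDuality.IsPureState ψ →
      ∀ (hΘ : ∀ a, ψ (TwistedDuality.CAR.Θ a) = ψ a) (Λ : Set ℤ),
        TwistedDuality.CAR.TwistedHaagDuality ψ hΘ Λ ↔
          TwistedDuality.CAR.EvenHaagDuality ψ Λ) ∧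
    (∀ (φ : TwistedDuality.Spin →ₚ[ℂ] ℂ), TwistedDuality.IsPureState φ →
      (∀ a, φ (TwistedDuality.Spin.Θ a) = φ a) → ∀ (Λ : Set ℤ),
        TwistedDuality.Spin.HaagDuality φ Λ ↔
          TwistedDuality.Spin.EvenHaagDuality φ Λ) :=
  ⟨fun ψ hψ hΘ Λ => mainTheorem8_general.1 ψ hΘ Λ (.inl hψ),
    fun φ hφ hΘ Λ => mainTheorem8_general.2 φ hΘ Λ (.inl hφ)⟩
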